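/- Let $K$ be a field of arbitrary characteristic. A Poisson algebra over $K$ is a commutative associative unital $K$-algebra $P$ with a $K$-bilinear Lie bracket $\{\cdot,\cdot\}$ satisfying Leibniz's rule $\{a,xy\}=\{a,x\}y+x\{a,y\}$. Write ${\rm pad}_a=\{a,\cdot\}$ and ${\rm PZ}(P)=\{a\in P \mid \{a,x\}=0 \text{ for all } x\in P\}$ (the Poisson centre). A Poisson derivation of $P$ is a $K$-derivation $\delta$ with $\delta(\{a,b\})=\{\delta(a),b\}+\{a,\delta(b)\}$ for all $a,b\in P$. A Poisson ideal of $P$ is an ideal $I$ with $\{P,I\}\subseteq I$. The algebra $P\mathcal D(P)$ of Poisson differential operators is the subalgebra of the algebra of differential operators on $P$ (hence of ${\rm End}_K(P)$) generated by the multiplications by elements of $P$ and by all ${\rm pad}_a$, $a\in P$. Let $D$ be a Poisson algebra over $K$, $n\ge 0$, $\partial=(\partial_1,\ldots,\partial_n)$ an $n$-tuple of commuting Poisson derivations of $D$, and $a=(a_1,\ldots,a_n)\in{\rm PZ}(D)^n$ with $\partial_i(a_j)=0$ for all $i\ne j$. The generalized Weyl Poisson algebra (GWPA) $A=D[X,Y;a,\partial\}$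 of rank $n$ is the algebra $D[X_1,\ldots,X_n,Y_1,\ldots,Y_n]/(X_1Y_1-a_1,\ldots,X_nY_n-a_n)$ with the unique Poisson bracket that extends the bracket of $D$ and satisfies, for all $i$ and all $d\in D$, $\{Y_i,d\}=\partial_i(d)Y_i$, $\{X_i,d\}=-\partial_i(d)X_i$, $\{Y_i,X_i\}=\partial_i(a_i)$, and $\{X_i,X_j\}=\{X_i,Y_j\}=\{Y_i,Y_j\}=0$ for all $i\neq j$. An ideal $I$ of $D$ is $\partial$-invariant if $\partial_i(I)\subseteq I$ for all $i$; put $D^\partial=\{d\in D\mid \partial_1(d)=\cdots=\partial_n(d)=0\}$ and ${\rm PZ}(D)^\partial={\rm PZ}(D)\cap D^\partial$. Then the following statements are equivalent: 1. The algebra $P\mathcal D(A)$ is a simple algebra. 2. (a) The only $\partial$-invariant Poisson ideals of $D$ are $0$ and $D$; (b) $Da_i+D\partial_i(a_i)=D$ for all $i=1,\ldots,n$; and (c) the algebra ${\rm PZ}(A)$ is a field. Moreover, if $n\ge 1$, then ${\rm PZ}(A)$ is a field if and only if ${\rm char}(K)=0$, ${\rm PZ}(D)^\partial$ is a field, and $D_\alpha=0$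 for all $\alpha\in\mathbb Z^n\setminus\{0\}$, where $$D_\alpha=\Big\{\lambda\in D^\partial \ \Big|\ {\rm pad}_\lambda=\lambda\sum_{i=1}^n\alpha_i\partial_i,\ \ \lambda\alpha_i\partial_i(a_i)=0 \text{ for } i=1,\ldots,n\Big\}.$$ -/

import Mathlib

set_option linter.unusedSimpArgs false

noncomputable section

/-- A (commutative, associative, unital) Poisson algebra `P` over `K`: a `K`-bilinear bracket
`{x, y} = bracket x y` which is a Lie bracket (alternating, Jacobi identity) and satisfies
Leibniz's rule. -/
class PoissonAlgebra (K : Type*) (P : Type*) [CommRing K] [CommRing P] [Algebra K P] where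
  /-- the Poisson bracket `{x, y}` -/
  bracket : P →ₗ[K] P →ₗ[K] P
  bracket_self : ∀ x, bracket x x = 0
  jacobi : ∀ x y z, bracket x (bracket y z) + bracket y (bracket z x) + bracket z (bracket x y) = 0
  leibniz : ∀ x y z, bracket x (y * z) = bracket x y * z + y * bracket x z

namespace PoissonAlgebra

section Basic

variable (K : Type*) {P : Type*} [CommRing K] [CommRing P] [Algebra K P] [PoissonAlgebra K P]

/-- The Hamiltonian vector field `pad x = {x, ·}`, a `K`-derivation of `P`. -/
def pad (x : P) : Derivation K P P :=
  Derivation.mk' (bracket (K := K) x) (fun y z => by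
    rw [leibniz, smul_eq_mul, smul_eq_mul]; ring)

theorem pad_apply (x y : P) : pad K x y = bracket (K := K) x y := rfl

theorem pad_self (x : P) : pad K x x = 0 := bracket_self x

theorem pad_add_left (x y : P) : pad K (x + y) = pad K x + pad K y := by
  ext z; simp [pad_apply]

theorem pad_smul_left (k : K) (x : P) : pad K (k • x) = k • pad K x := by
  ext z; simp [pad_apply]

theorem pad_skew (x y : P) : pad K x y = - pad K y x := by
  have h := pad_self K (x + y)
  rw [pad_add_left, Derivation.add_apply, map_add, map_add, pad_self, pad_self] at h
  rw [eq_neg_iff_add_eq_zero]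
  simpa using h

theorem pad_mul_left (x y : P) : pad K (x * y) = x • pad K y + y • pad K x := by
  ext z
  rw [pad_skew, Derivation.leibniz, pad_skew K z y, pad_skew K z x]
  simp only [Derivation.add_apply, Derivation.smul_apply, smul_eq_mul]
  ring

variable (P)

/-- The Poisson centre `PZ(P) = {x ∈ P | {x, y} = 0 for all y ∈ P}`, a subalgebra of `P`. -/
def center : Subalgebra K P where
  carrier := {x | ∀ y, pad K x y = 0}
  mul_mem' := fun {x y} hx hy z => by simp [pad_mul_left, hx z, hy z]
  add_mem' := fun {x y} hx hy z => by simp [pad_add_left, hx z, hy z]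
  algebraMap_mem' := fun k y => by rw [pad_skew]; simp

/-- The algebra `PD(P)` of Poisson differential operators on `P`: the `K`-subalgebra generated by
the multiplications by elements of `P` and by the Hamiltonian vector fields `{x, ·}`. These
generators are differential operators on `P` of order at most `0` and `1` respectively, so the
subalgebra they generate in the algebra of differential operators on `P` is the same as the one
they generate in the ambient algebra `End_K(P)`. -/
def diffOp : Subalgebra K (Module.End K P) :=
  Algebra.adjoin K
    (Set.range (fun x : P => LinearMap.mulLeft K x) ∪
      Set.range (fun x : P => (pad K x : P →ₗ[K] P)))

variable {P}

/-- `I` is a Poisson ideal: `{P, I} ⊆ I`. -/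
def IsPoissonIdeal (I : Ideal P) : Prop := ∀ x : P, ∀ y ∈ I, pad K x y ∈ I

variable {K}

/-- `δ` is a Poisson derivation: `δ{x, y} = {δ x, y} + {x, δ y}`. -/
def IsPoissonDerivation (δ : Derivation K P P) : Prop :=
  ∀ x y, δ (pad K x y) = pad K (δ x) y + pad K x (δ y)

end Basic

end PoissonAlgebra

open PoissonAlgebra in
/-- The defining data of a generalized Weyl Poisson algebra of rank `n` over the Poisson
algebra `D`: an `n`-tuple `der = (∂₁, …, ∂ₙ)` of commuting Poisson derivations of `D` and an
`n`-tuple `a = (a₁, …, aₙ)` of Poisson central elements of `D` with `∂ᵢ(aⱼ) = 0` for `i ≠ j`. -/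
structure GWPAData (K D : Type*) [CommRing K] [CommRing D] [Algebra K D] [PoissonAlgebra K D]
    (n : ℕ) where
  a : Fin n → D
  der : Fin n → Derivation K D D
  der_poisson : ∀ i, IsPoissonDerivation (der i)
  der_comm : ∀ i j x, der i (der j x) = der j (der i x)
  a_mem : ∀ i, a i ∈ center K D
  der_a : ∀ i j, i ≠ j → der i (a j) = 0

namespace GWPAData

variable {K D : Type*} [CommRing K] [CommRing D] [Algebra K D] [PoissonAlgebra K D] {n : ℕ}

/-- The ideal `I` of `D` is `∂`-invariant: `∂ᵢ(I) ⊆ I` for all `i`. -/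
def IsInvariant (G : GWPAData K D n) (I : Ideal D) : Prop := ∀ i, ∀ x ∈ I, G.der i x ∈ I

/-- The algebra of `∂`-constants `D^∂ = {d ∈ D | ∂₁(d) = 0, …, ∂ₙ(d) = 0}`. -/
def constants (G : GWPAData K D n) : Subalgebra K D where
  carrier := {d | ∀ i, G.der i d = 0}
  mul_mem' := fun {x y} hx hy i => by simp [hx i, hy i]
  add_mem' := fun {x y} hx hy i => by simp [hx i, hy i]
  algebraMap_mem' := fun k i => by simp

/-- For `α ∈ ℤⁿ`, the set
`D_α = {λ ∈ D^∂ | pad λ = λ ∑ᵢ αᵢ ∂ᵢ and λ αᵢ ∂ᵢ(aᵢ) = 0 for i = 1, …, n}`. -/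
def weight (G : GWPAData K D n) (α : Fin n → ℤ) : Set D :=
  {l | l ∈ G.constants ∧ PoissonAlgebra.pad K l = l • ∑ i, α i • G.der i ∧
    ∀ i, l * (α i : D) * G.der i (G.a i) = 0}

end GWPAData

/-- The commutative generalized Weyl algebra
`D[X₁, …, Xₙ, Y₁, …, Yₙ] / (X₁Y₁ - a₁, …, XₙYₙ - aₙ)` underlying the generalized Weyl Poisson
algebra given by `G`; `Xᵢ` is the variable `Sum.inl i` and `Yᵢ` is the variable `Sum.inr i`. -/
def GWPA {K D : Type*} [CommRing K] [CommRing D] [Algebra K D] [PoissonAlgebra K D] {n : ℕ}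
    (G : GWPAData K D n) : Type _ :=
  MvPolynomial (Fin n ⊕ Fin n) D ⧸
    Ideal.span (Set.range fun i : Fin n =>
      (MvPolynomial.X (Sum.inl i) * MvPolynomial.X (Sum.inr i) - MvPolynomial.C (G.a i) :
        MvPolynomial (Fin n ⊕ Fin n) D))

namespace GWPA

variable {K D : Type*} [CommRing K] [CommRing D] [Algebra K D] [PoissonAlgebra K D] {n : ℕ}
variable (G : GWPAData K D n)

instance : CommRing (GWPA G) := inferInstanceAs (CommRing (_ ⧸ _))

instance : Algebra D (GWPA G) := inferInstanceAs (Algebra D (_ ⧸ _))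

instance : Algebra K (GWPA G) := inferInstanceAs (Algebra K (_ ⧸ _))

instance : IsScalarTower K D (GWPA G) := inferInstanceAs (IsScalarTower K D (_ ⧸ _))

/-- The quotient map from the polynomial algebra. -/
def mk : MvPolynomial (Fin n ⊕ Fin n) D →+* GWPA G := Ideal.Quotient.mk _

/-- The generator `Xᵢ`. -/
def X (i : Fin n) : GWPA G := mk G (MvPolynomial.X (Sum.inl i))

/-- The generator `Yᵢ`. -/
def Y (i : Fin n) : GWPA G := mk G (MvPolynomial.X (Sum.inr i))

/-- The canonical map `D → A`. -/
abbrev ι (d : D) : GWPA G := algebraMap D (GWPA G) d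

theorem mk_C (d : D) : mk G (MvPolynomial.C d) = ι G d := rfl

theorem mk_surjective : Function.Surjective (mk G) := Ideal.Quotient.mk_surjective

theorem X_mul_Y (i : Fin n) : X G i * Y G i = ι G (G.a i) := by
  rw [X, Y, ← map_mul, ← mk_C, ← sub_eq_zero, ← map_sub]
  exact Ideal.Quotient.eq_zero_iff_mem.2 (Ideal.subset_span ⟨i, rfl⟩)

theorem algebraMap_eq (k : K) : algebraMap K (GWPA G) k = ι G (algebraMap K D k) := rfl

variable {G}

/-- Induction principle: `A` is generated by `D`, the `Xᵢ` and the `Yᵢ`. -/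
theorem induction {p : GWPA G → Prop} (hD : ∀ d, p (ι G d)) (hX : ∀ i, p (X G i))
    (hY : ∀ i, p (Y G i)) (hadd : ∀ x y, p x → p y → p (x + y))
    (hmul : ∀ x y, p x → p y → p (x * y)) (x : GWPA G) : p x := by
  obtain ⟨f, rfl⟩ := mk_surjective G x
  induction f using MvPolynomial.induction_on with
  | C d => exact hD d
  | add f g hf hg => rw [map_add]; exact hadd _ _ hf hg
  | mul_X f i hf =>
    rw [map_mul]
    refine hmul _ _ hf ?_
    rcases i with i | i
    · exact hX i
    · exact hY i

section Der

variable {M : Type*} [AddCommGroup M] [Module K M] [Module (GWPA G) M]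

theorem der_ext {d e : Derivation K (GWPA G) M} (hD : ∀ r, d (ι G r) = e (ι G r))
    (hX : ∀ i, d (X G i) = e (X G i)) (hY : ∀ i, d (Y G i) = e (Y G i)) : d = e := by
  ext x
  refine induction (p := fun x => d x = e x) hD hX hY (fun x y hx hy => ?_) (fun x y hx hy => ?_) x
  · rw [map_add, map_add, hx, hy]
  · rw [Derivation.leibniz, Derivation.leibniz, hx, hy]

theorem exists_der_aux [IsScalarTower K (GWPA G) M] [Module (GWPA G)ᵐᵒᵖ M]
    [IsCentralScalar (GWPA G) M] (δ : D →+ M) (hK : ∀ k : K, δ (algebraMap K D k) = 0)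
    (hδ : ∀ r s, δ (r * s) = ι G r • δ s + ι G s • δ r)
    (x y : Fin n → M) (hxy : ∀ i, X G i • y i + Y G i • x i = δ (G.a i)) :
    ∃ d : Derivation K (GWPA G) M,
      (∀ r, d (ι G r) = δ r) ∧ (∀ i, d (X G i) = x i) ∧ (∀ i, d (Y G i) = y i) := by
  let j : D →+* TrivSqZeroExt (GWPA G) M :=
    { toFun := fun r => TrivSqZeroExt.inl (ι G r) + TrivSqZeroExt.inr (δ r)
      map_one' := by
        have h : δ 1 = 0 := by rw [← map_one (algebraMap K D)]; exact hK 1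
        rw [h]; ext <;> simp
      map_zero' := by ext <;> simp
      map_add' := fun r s => by ext <;> simp
      map_mul' := fun r s => by ext <;> simp [hδ] }
  let φ₀ : MvPolynomial (Fin n ⊕ Fin n) D →+* TrivSqZeroExt (GWPA G) M :=
    MvPolynomial.eval₂Hom j (Sum.elim
      (fun i => TrivSqZeroExt.inl (X G i) + TrivSqZeroExt.inr (x i))
      (fun i => TrivSqZeroExt.inl (Y G i) + TrivSqZeroExt.inr (y i)))
  have h₀ : ∀ f ∈ Ideal.span (Set.range fun i : Fin n =>
      (MvPolynomial.X (Sum.inl i) * MvPolynomial.X (Sum.inr i) - MvPolynomial.C (G.a i) :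
        MvPolynomial (Fin n ⊕ Fin n) D)), φ₀ f = 0 := by
    intro f hf
    have : Ideal.span (Set.range fun i : Fin n =>
      (MvPolynomial.X (Sum.inl i) * MvPolynomial.X (Sum.inr i) - MvPolynomial.C (G.a i) :
        MvPolynomial (Fin n ⊕ Fin n) D)) ≤ RingHom.ker φ₀ := by
      rw [Ideal.span_le]
      rintro _ ⟨i, rfl⟩
      rw [SetLike.mem_coe, RingHom.mem_ker]
      ext
      · simp [φ₀, j, X_mul_Y]
      · simp [φ₀, j, hxy]
    exact this hf
  let φ : GWPA G →+* TrivSqZeroExt (GWPA G) M := Ideal.Quotient.lift _ φ₀ h₀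
  have hφD : ∀ r, φ (ι G r) = TrivSqZeroExt.inl (ι G r) + TrivSqZeroExt.inr (δ r) := fun r => by
    change φ₀ (MvPolynomial.C r) = _
    simp [φ₀, j]
  have hφX : ∀ i, φ (X G i) = TrivSqZeroExt.inl (X G i) + TrivSqZeroExt.inr (x i) := fun i => by
    change φ₀ (MvPolynomial.X _) = _
    simp [φ₀]
  have hφY : ∀ i, φ (Y G i) = TrivSqZeroExt.inl (Y G i) + TrivSqZeroExt.inr (y i) := fun i => by
    change φ₀ (MvPolynomial.X _) = _
    simp [φ₀]
  have hfst : ∀ z, (φ z).fst = z := by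
    intro z
    refine induction (p := fun z => (φ z).fst = z) (fun d => ?_) (fun i => ?_) (fun i => ?_)
      (fun x y hx hy => ?_) (fun x y hx hy => ?_) z
    · simp [hφD]
    · simp [hφX]
    · simp [hφY]
    · rw [map_add, TrivSqZeroExt.fst_add, hx, hy]
    · rw [map_mul, TrivSqZeroExt.fst_mul, hx, hy]
  refine ⟨Derivation.mk'
    { toFun := fun z => (φ z).snd
      map_add' := fun z w => by rw [map_add, TrivSqZeroExt.snd_add]
      map_smul' := fun k z => by
        rw [Algebra.smul_def, algebraMap_eq, map_mul, TrivSqZeroExt.snd_mul, hfst, hfst, hφD, hK]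
        simp [← algebraMap_eq] } (fun z w => ?_), ?_, ?_, ?_⟩
  · change (φ (z * w)).snd = z • (φ w).snd + w • (φ z).snd
    rw [map_mul, TrivSqZeroExt.snd_mul, hfst, hfst, op_smul_eq_smul]
  · intro r; change (φ _).snd = _; simp [hφD]
  · intro i; change (φ _).snd = _; simp [hφX]
  · intro i; change (φ _).snd = _; simp [hφY]

/-- The universal property used to build the bracket: derivations of `A` with values in an
`A`-module `M` and with prescribed values `δ` on `D`, `xᵢ` on `Xᵢ`, `yᵢ` on `Yᵢ` exist as soon as
the prescription is compatible with the relations `XᵢYᵢ = aᵢ`. -/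
theorem exists_der [IsScalarTower K (GWPA G) M] (δ : D →+ M)
    (hK : ∀ k : K, δ (algebraMap K D k) = 0)
    (hδ : ∀ r s, δ (r * s) = ι G r • δ s + ι G s • δ r)
    (x y : Fin n → M) (hxy : ∀ i, X G i • y i + Y G i • x i = δ (G.a i)) :
    ∃ d : Derivation K (GWPA G) M,
      (∀ r, d (ι G r) = δ r) ∧ (∀ i, d (X G i) = x i) ∧ (∀ i, d (Y G i) = y i) := by
  let _ : Module (GWPA G)ᵐᵒᵖ M :=
    Module.compHom M ((RingEquiv.toOpposite (GWPA G)).symm.toRingHom : (GWPA G)ᵐᵒᵖ →+* GWPA G)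
  have : IsCentralScalar (GWPA G) M := ⟨fun _ _ => rfl⟩
  exact exists_der_aux δ hK hδ x y hxy

end Der

section Bracket

open PoissonAlgebra

variable (G)

theorem exists_padD (d : D) : ∃ e : Derivation K (GWPA G) (GWPA G),
    (∀ r, e (ι G r) = ι G (pad K d r)) ∧ (∀ i, e (X G i) = ι G (G.der i d) * X G i) ∧
      (∀ i, e (Y G i) = -(ι G (G.der i d) * Y G i)) := by
  refine exists_der
    ((algebraMap D (GWPA G)).toAddMonoidHom.comp (pad K d : D →ₗ[K] D).toAddMonoidHom) ?_ ?_
    (fun i => ι G (G.der i d) * X G i) (fun i => -(ι G (G.der i d) * Y G i)) ?_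
  · intro k
    simp
  · intro r s
    simp
  · intro i
    have h : pad K d (G.a i) = 0 := by rw [pad_skew, G.a_mem i d, neg_zero]
    simp only [smul_eq_mul, AddMonoidHom.comp_apply, LinearMap.toAddMonoidHom_coe,
      Derivation.coeFn_coe, h, map_zero]
    ring

theorem exists_padX (j : Fin n) : ∃ e : Derivation K (GWPA G) (GWPA G),
    (∀ r, e (ι G r) = -(ι G (G.der j r) * X G j)) ∧ (∀ i, e (X G i) = 0) ∧
      (∀ i, e (Y G i) = if i = j then -ι G (G.der j (G.a j)) else 0) := by
  refine exists_der
    ((-(AddMonoidHom.mulRight (X G j))).comp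
      ((algebraMap D (GWPA G)).toAddMonoidHom.comp (G.der j : D →ₗ[K] D).toAddMonoidHom)) ?_ ?_
    (fun i => 0) (fun i => if i = j then -ι G (G.der j (G.a j)) else 0) ?_
  · intro k
    simp
  · intro r s
    simp
    ring
  · intro i
    rcases eq_or_ne i j with rfl | h
    · simp
      ring
    · simp [h, G.der_a j i h.symm]

theorem exists_padY (j : Fin n) : ∃ e : Derivation K (GWPA G) (GWPA G),
    (∀ r, e (ι G r) = ι G (G.der j r) * Y G j) ∧
      (∀ i, e (X G i) = if i = j then ι G (G.der j (G.a j)) else 0) ∧ (∀ i, e (Y G i) = 0) := by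
  refine exists_der
    ((AddMonoidHom.mulRight (Y G j)).comp
      ((algebraMap D (GWPA G)).toAddMonoidHom.comp (G.der j : D →ₗ[K] D).toAddMonoidHom)) ?_ ?_
    (fun i => if i = j then ι G (G.der j (G.a j)) else 0) (fun i => 0) ?_
  · intro k
    simp
  · intro r s
    simp
    ring
  · intro i
    rcases eq_or_ne i j with rfl | h
    · simp
      ring
    · simp [h, G.der_a j i h.symm]

/-- The derivation `{d, ·}` of `A`, for `d ∈ D`. -/
def padD (d : D) : Derivation K (GWPA G) (GWPA G) := (exists_padD G d).choose

/-- The derivation `{Xⱼ, ·}` of `A`. -/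
def padX (j : Fin n) : Derivation K (GWPA G) (GWPA G) := (exists_padX G j).choose

/-- The derivation `{Yⱼ, ·}` of `A`. -/
def padY (j : Fin n) : Derivation K (GWPA G) (GWPA G) := (exists_padY G j).choose

theorem padD_D (d r : D) : padD G d (ι G r) = ι G (pad K d r) :=
  (exists_padD G d).choose_spec.1 r
theorem padD_X (d : D) (i : Fin n) : padD G d (X G i) = ι G (G.der i d) * X G i :=
  (exists_padD G d).choose_spec.2.1 i
theorem padD_Y (d : D) (i : Fin n) : padD G d (Y G i) = -(ι G (G.der i d) * Y G i) :=
  (exists_padD G d).choose_spec.2.2 i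
theorem padX_D (j : Fin n) (r : D) : padX G j (ι G r) = -(ι G (G.der j r) * X G j) :=
  (exists_padX G j).choose_spec.1 r
theorem padX_X (j i : Fin n) : padX G j (X G i) = 0 :=
  (exists_padX G j).choose_spec.2.1 i
theorem padX_Y (j i : Fin n) :
    padX G j (Y G i) = if i = j then -ι G (G.der j (G.a j)) else 0 :=
  (exists_padX G j).choose_spec.2.2 i
theorem padY_D (j : Fin n) (r : D) : padY G j (ι G r) = ι G (G.der j r) * Y G j :=
  (exists_padY G j).choose_spec.1 r
theorem padY_X (j i : Fin n) :
    padY G j (X G i) = if i = j then ι G (G.der j (G.a j)) else 0 :=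
  (exists_padY G j).choose_spec.2.1 i
theorem padY_Y (j i : Fin n) : padY G j (Y G i) = 0 :=
  (exists_padY G j).choose_spec.2.2 i

/-- `padD` as an additive map. -/
def padDHom : D →+ Derivation K (GWPA G) (GWPA G) where
  toFun := padD G
  map_zero' := by
    refine der_ext (fun r => ?_) (fun i => ?_) (fun i => ?_)
    · simp only [padD_D, pad_skew K 0 r]; simp
    · simp [padD_X]
    · simp [padD_Y]
  map_add' := fun d e => by
    refine der_ext (fun r => ?_) (fun i => ?_) (fun i => ?_)
    · simp [padD_D, pad_add_left]
    · simp [padD_X, add_mul]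
    · simp [padD_Y, add_mul, add_comm]

theorem exists_padA :
    ∃ e : Derivation K (GWPA G) (Derivation K (GWPA G) (GWPA G)),
      (∀ r, e (ι G r) = padDHom G r) ∧ (∀ i, e (X G i) = padX G i) ∧
        (∀ i, e (Y G i) = padY G i) := by
  refine exists_der (padDHom G) ?_ ?_ (padX G) (padY G) ?_
  · intro k
    refine der_ext (fun r => ?_) (fun i => ?_) (fun i => ?_)
    · change padD G _ _ = _
      rw [padD_D, pad_skew]; simp
    · change padD G _ _ = _
      rw [padD_X]; simp
    · change padD G _ _ = _
      rw [padD_Y]; simp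
  · intro r s
    refine der_ext (fun t => ?_) (fun i => ?_) (fun i => ?_)
    · change padD G _ _ = ι G r * padD G _ _ + ι G s * padD G _ _
      simp [padD_D, pad_mul_left]
    · change padD G _ _ = ι G r * padD G _ _ + ι G s * padD G _ _
      simp [padD_X]
      ring
    · change padD G _ _ = ι G r * padD G _ _ + ι G s * padD G _ _
      simp [padD_Y]
      ring
  · intro i
    refine der_ext (fun t => ?_) (fun j => ?_) (fun j => ?_)
    · change X G i * padY G i _ + Y G i * padX G i _ = padD G _ _
      rw [padY_D, padX_D, padD_D, G.a_mem i t]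
      simp only [ι, map_zero]
      ring
    · change X G i * padY G i _ + Y G i * padX G i _ = padD G _ _
      rw [padY_X, padX_X, padD_X]
      rcases eq_or_ne j i with rfl | h
      · simp; ring
      · simp [h, G.der_a j i h]
    · change X G i * padY G i _ + Y G i * padX G i _ = padD G _ _
      rw [padY_Y, padX_Y, padD_Y]
      rcases eq_or_ne j i with rfl | h
      · simp; ring
      · simp [h, G.der_a j i h]

/-- The biderivation `x ↦ {x, ·}` of `A`; it is the only one which extends the bracket of `D` and
has the values `{Yᵢ, d} = ∂ᵢ(d)Yᵢ`, `{Xᵢ, d} = -∂ᵢ(d)Xᵢ`, `{Yᵢ, Xᵢ} = ∂ᵢ(aᵢ)`, and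
`{Xᵢ, Xⱼ} = {Xᵢ, Yⱼ} = {Yᵢ, Yⱼ} = 0` for `i ≠ j`. -/
def padA : Derivation K (GWPA G) (Derivation K (GWPA G) (GWPA G)) := (exists_padA G).choose

theorem padA_D (d : D) : padA G (ι G d) = padD G d := (exists_padA G).choose_spec.1 d
theorem padA_X (i : Fin n) : padA G (X G i) = padX G i := (exists_padA G).choose_spec.2.1 i
theorem padA_Y (i : Fin n) : padA G (Y G i) = padY G i := (exists_padA G).choose_spec.2.2 i

theorem padA_add (x y z : GWPA G) : padA G (x + y) z = padA G x z + padA G y z := by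
  rw [map_add, Derivation.add_apply]

theorem padA_mul (x y z : GWPA G) :
    padA G (x * y) z = x * padA G y z + y * padA G x z := by
  rw [Derivation.leibniz]; rfl

theorem padA_mul' (x y z : GWPA G) :
    padA G x (y * z) = y * padA G x z + z * padA G x y := by
  rw [Derivation.leibniz]; rfl

theorem padA_skew (x y : GWPA G) : padA G x y + padA G y x = 0 := by
  revert y
  refine induction (p := fun x => ∀ y, padA G x y + padA G y x = 0)
    (fun d => ?_) (fun i => ?_) (fun i => ?_) (fun x x' hx hx' y => ?_)
    (fun x x' hx hx' y => ?_) x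
  · refine induction (fun e => ?_) (fun j => ?_) (fun j => ?_) (fun y z hy hz => ?_)
      (fun y z hy hz => ?_)
    · rw [padA_D, padA_D, padD_D, padD_D, ← map_add, pad_skew]; simp
    · rw [padA_D, padA_X, padD_X, padX_D]; ring
    · rw [padA_D, padA_Y, padD_Y, padY_D]; ring
    · rw [map_add, padA_add]; linear_combination hy + hz
    · rw [padA_mul', padA_mul]; linear_combination z * hy + y * hz
  · refine induction (fun e => ?_) (fun j => ?_) (fun j => ?_) (fun y z hy hz => ?_)
      (fun y z hy hz => ?_)
    · rw [padA_D, padA_X, padD_X, padX_D]; ring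
    · rw [padA_X, padA_X, padX_X, padX_X]; ring
    · rw [padA_X, padA_Y, padX_Y, padY_X]
      rcases eq_or_ne j i with rfl | h
      · simp
      · simp [h, h.symm]
    · rw [map_add, padA_add]; linear_combination hy + hz
    · rw [padA_mul', padA_mul]; linear_combination z * hy + y * hz
  · refine induction (fun e => ?_) (fun j => ?_) (fun j => ?_) (fun y z hy hz => ?_)
      (fun y z hy hz => ?_)
    · rw [padA_D, padA_Y, padD_Y, padY_D]; ring
    · rw [padA_X, padA_Y, padX_Y, padY_X]
      rcases eq_or_ne j i with rfl | h
      · simp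
      · simp [h, h.symm]
    · rw [padA_Y, padA_Y, padY_Y, padY_Y]; ring
    · rw [map_add, padA_add]; linear_combination hy + hz
    · rw [padA_mul', padA_mul]; linear_combination z * hy + y * hz
  · rw [padA_add, map_add]; linear_combination hx y + hx' y
  · rw [padA_mul', padA_mul]; linear_combination x * hx' y + x' * hx y

theorem padA_self (x : GWPA G) : padA G x x = 0 := by
  refine induction (p := fun x => padA G x x = 0)
    (fun d => ?_) (fun i => ?_) (fun i => ?_) (fun x y hx hy => ?_) (fun x y hx hy => ?_) x
  · rw [padA_D, padD_D, pad_self]; simp only [ι, map_zero]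
  · rw [padA_X, padX_X]
  · rw [padA_Y, padY_Y]
  · rw [map_add, padA_add, padA_add]; linear_combination hx + hy + padA_skew G x y
  · rw [padA_mul', padA_mul, padA_mul]
    linear_combination y * y * hx + x * x * hy + x * y * padA_skew G x y

/-- The Jacobiator of the bracket on `A`. -/
def jac (x y z : GWPA G) : GWPA G :=
  padA G x (padA G y z) + padA G y (padA G z x) + padA G z (padA G x y)

theorem jac_rot (x y z : GWPA G) : jac G y z x = jac G x y z := by
  rw [jac, jac]; ring

theorem padA_swap (x y : GWPA G) : padA G x y = - padA G y x :=
  eq_neg_of_add_eq_zero_left (padA_skew G x y)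

theorem jac_swap (x y z : GWPA G) : jac G y x z = - jac G x y z := by
  rw [jac, jac, padA_swap G x z, padA_swap G z y, padA_swap G y x]
  simp only [map_neg]; ring

theorem jac_add (x x' y z : GWPA G) : jac G (x + x') y z = jac G x y z + jac G x' y z := by
  simp only [jac, map_add, Derivation.add_apply]; ring

theorem jac_mul (x x' y z : GWPA G) :
    jac G (x * x') y z = x * jac G x' y z + x' * jac G x y z := by
  simp only [jac, padA_mul, padA_mul', map_add]
  rw [padA_swap G x' y, padA_swap G x y]
  simp only [map_neg]
  ring

theorem jac_ind {y z : GWPA G} (hD : ∀ d, jac G (ι G d) y z = 0) (hX : ∀ i, jac G (X G i) y z = 0)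
    (hY : ∀ i, jac G (Y G i) y z = 0) (x : GWPA G) : jac G x y z = 0 := by
  refine induction (p := fun x => jac G x y z = 0) hD hX hY
    (fun x y hx hy => ?_) (fun x y hx hy => ?_) x
  · rw [jac_add, hx, hy, add_zero]
  · rw [jac_mul, hx, hy, mul_zero, mul_zero, add_zero]

theorem jac_DDD (d e f : D) : jac G (ι G d) (ι G e) (ι G f) = 0 := by
  have h := PoissonAlgebra.jacobi (K := K) d e f
  simp only [← pad_apply] at h
  simp only [jac, padA_D, padD_D, ← map_add, h, map_zero]

theorem jac_DDX (d e : D) (i : Fin n) : jac G (ι G d) (ι G e) (X G i) = 0 := by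
  have h := G.der_poisson i d e
  have h' := congrArg (ι G) h
  have h2 := congrArg (ι G) (pad_skew K (G.der i d) e)
  simp only [ι, map_add, map_neg] at h' h2
  simp only [jac, padA_D, padA_X, padX_D, padD_D, padD_X, Derivation.leibniz, smul_eq_mul, map_neg, h', ι, h2]
  ring

theorem jac_DDY (d e : D) (i : Fin n) : jac G (ι G d) (ι G e) (Y G i) = 0 := by
  have h := G.der_poisson i d e
  have h' := congrArg (ι G) h
  have h2 := congrArg (ι G) (pad_skew K (G.der i d) e)
  simp only [ι, map_add, map_neg] at h' h2
  simp only [jac, padA_D, padA_Y, padY_D, padD_D, padD_Y, Derivation.leibniz, smul_eq_mul, map_neg, h', ι, h2]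
  ring

theorem jac_DXX (d : D) (i j : Fin n) : jac G (ι G d) (X G i) (X G j) = 0 := by
  simp only [jac, padA_D, padA_X, padX_D, padD_X, padX_X, Derivation.leibniz, smul_eq_mul, map_neg, map_zero,
    G.der_comm i j]
  ring

theorem jac_DYY (d : D) (i j : Fin n) : jac G (ι G d) (Y G i) (Y G j) = 0 := by
  simp only [jac, padA_D, padA_Y, padY_D, padD_Y, padY_Y, Derivation.leibniz, smul_eq_mul, map_neg, map_zero,
    G.der_comm i j]
  ring

theorem pad_der_a (i : Fin n) (d : D) : pad K d (G.der i (G.a i)) = 0 := by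
  have h := G.der_poisson i d (G.a i)
  rw [pad_skew K d, pad_skew K (G.der i d), G.a_mem i, G.a_mem i] at h
  simpa using h.symm

theorem der_der_a (i j : Fin n) (h : i ≠ j) : G.der j (G.der i (G.a i)) = 0 := by
  rw [G.der_comm, G.der_a j i h.symm, map_zero]

theorem jac_DXY (d : D) (i j : Fin n) : jac G (ι G d) (X G i) (Y G j) = 0 := by
  rcases eq_or_ne i j with rfl | h
  · simp only [jac, padA_D, padA_X, padA_Y, padX_D, padY_D, padD_X, padD_Y, padX_Y, padY_X,
      padD_D, Derivation.leibniz, smul_eq_mul, map_neg, if_true, pad_der_a]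
    simp only [ι, map_zero]
    ring
  · simp only [jac, padA_D, padA_X, padA_Y, padX_D, padY_D, padD_X, padD_Y, padX_Y, padY_X,
      padD_D, Derivation.leibniz, smul_eq_mul, map_neg, map_zero, if_neg h, if_neg h.symm, G.der_comm i j]
    ring

theorem jac_XXX (i j k : Fin n) : jac G (X G i) (X G j) (X G k) = 0 := by
  simp [jac, padA_X, padX_X]

theorem jac_YYY (i j k : Fin n) : jac G (Y G i) (Y G j) (Y G k) = 0 := by
  simp [jac, padA_Y, padY_Y]

theorem padA_X_c (i j : Fin n) (h : j ≠ i) : padA G (X G j) (ι G (G.der i (G.a i))) = 0 := by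
  rw [padA_X, padX_D, der_der_a G i j h.symm]; simp

theorem padA_Y_c (i j : Fin n) (h : j ≠ i) : padA G (Y G j) (ι G (G.der i (G.a i))) = 0 := by
  rw [padA_Y, padY_D, der_der_a G i j h.symm]; simp

theorem padA_X_Y (i j : Fin n) :
    padA G (X G i) (Y G j) = if j = i then -ι G (G.der i (G.a i)) else 0 := by
  rw [padA_X, padX_Y]

theorem padA_Y_X (i j : Fin n) :
    padA G (Y G i) (X G j) = if j = i then ι G (G.der i (G.a i)) else 0 := by
  rw [padA_Y, padY_X]

theorem padA_X_X (i j : Fin n) : padA G (X G i) (X G j) = 0 := by rw [padA_X, padX_X]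

theorem padA_Y_Y (i j : Fin n) : padA G (Y G i) (Y G j) = 0 := by rw [padA_Y, padY_Y]

theorem jac_XXY (i j k : Fin n) : jac G (X G i) (X G j) (Y G k) = 0 := by
  simp only [jac, padA_X_Y, padA_Y_X, padA_X_X]
  by_cases hj : k = j <;> by_cases hi : k = i
  · subst hj hi; simp
  · subst hj; simp [hi, Ne.symm hi, padA_X_c G k i (Ne.symm hi)]
  · subst hi; simp [hj, Ne.symm hj, padA_X_c G k j (Ne.symm hj)]
  · simp [hi, hj, Ne.symm hi, Ne.symm hj]

theorem jac_XYY (i j k : Fin n) : jac G (X G i) (Y G j) (Y G k) = 0 := by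
  simp only [jac, padA_X_Y, padA_Y_X, padA_Y_Y]
  by_cases hj : i = j <;> by_cases hk : i = k
  · subst hj hk; simp
  · subst hj; simp [hk, Ne.symm hk, padA_Y_c G i k (Ne.symm hk)]
  · subst hk; simp [hj, Ne.symm hj, padA_Y_c G i j (Ne.symm hj)]
  · simp [hk, hj, Ne.symm hk, Ne.symm hj]

theorem jac_eq_zero (x y z : GWPA G) : jac G x y z = 0 := by
  have r (x y z : GWPA G) (h : jac G x y z = 0) : jac G y z x = 0 := by rw [jac_rot, h]
  have s (x y z : GWPA G) (h : jac G x y z = 0) : jac G y x z = 0 := by rw [jac_swap, h, neg_zero]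
  have t (x y z : GWPA G) (h : jac G x y z = 0) : jac G x z y = 0 := r _ _ _ (s _ _ _ h)
  revert y z
  suffices H : ∀ z x y, jac G x y z = 0 from fun y z => H z x y
  intro z
  -- generators in the first two slots suffice, once they are handled for all third arguments
  have key (x y : GWPA G) (hD : ∀ d, jac G x y (ι G d) = 0) (hX : ∀ i, jac G x y (X G i) = 0)
      (hY : ∀ i, jac G x y (Y G i) = 0) : jac G x y z = 0 :=
    r _ _ _ (jac_ind G (fun d => r _ _ _ (r _ _ _ (hD d))) (fun i => r _ _ _ (r _ _ _ (hX i)))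
      (fun i => r _ _ _ (r _ _ _ (hY i))) z)
  have hDD (d e : D) : jac G (ι G d) (ι G e) z = 0 :=
    key _ _ (fun f => jac_DDD G d e f) (fun i => jac_DDX G d e i) (fun i => jac_DDY G d e i)
  have hDX (d : D) (i : Fin n) : jac G (ι G d) (X G i) z = 0 :=
    key _ _ (fun e => t _ _ _ (jac_DDX G d e i)) (fun j => jac_DXX G d i j)
      (fun j => jac_DXY G d i j)
  have hDY (d : D) (i : Fin n) : jac G (ι G d) (Y G i) z = 0 :=
    key _ _ (fun e => t _ _ _ (jac_DDY G d e i)) (fun j => t _ _ _ (jac_DXY G d j i))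
      (fun j => jac_DYY G d i j)
  have hXX (i j : Fin n) : jac G (X G i) (X G j) z = 0 :=
    key _ _ (fun d => r _ _ _ (jac_DXX G d i j)) (fun k => jac_XXX G i j k)
      (fun k => jac_XXY G i j k)
  have hXY (i j : Fin n) : jac G (X G i) (Y G j) z = 0 :=
    key _ _ (fun d => r _ _ _ (jac_DXY G d i j)) (fun k => t _ _ _ (jac_XXY G i k j))
      (fun k => jac_XYY G i j k)
  have hYY (i j : Fin n) : jac G (Y G i) (Y G j) z = 0 :=
    key _ _ (fun d => r _ _ _ (jac_DYY G d i j)) (fun k => r _ _ _ (jac_XYY G k i j))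
      (fun k => jac_YYY G i j k)
  intro x y
  refine jac_ind G (fun d => s _ _ _ ?_) (fun i => s _ _ _ ?_) (fun i => s _ _ _ ?_) x
  · exact jac_ind G (fun e => hDD e d) (fun i => s _ _ _ (hDX d i)) (fun i => s _ _ _ (hDY d i)) y
  · exact jac_ind G (fun d => hDX d i) (fun j => hXX j i) (fun j => s _ _ _ (hXY i j)) y
  · exact jac_ind G (fun d => hDY d i) (fun j => hXY j i) (fun j => hYY j i) y

/-- The Poisson structure of the generalized Weyl Poisson algebra `A = D[X, Y; a, ∂}`. -/
instance : PoissonAlgebra K (GWPA G) where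
  bracket := LinearMap.mk₂ K (fun x y => padA G x y) (padA_add G)
    (fun k x y => by rw [Derivation.map_smul, Derivation.smul_apply]) (fun x y z => map_add _ y z)
    (fun k x y => Derivation.map_smul _ _ _)
  bracket_self := padA_self G
  jacobi := jac_eq_zero G
  leibniz := fun x y z => by
    simp only [LinearMap.mk₂_apply, padA_mul']; ring

/-- `D → A` is a homomorphism of Poisson algebras. -/
theorem pad_D_D (d e : D) : pad K (ι G d) (ι G e) = ι G (pad K d e) := by
  change padA G _ _ = _
  rw [padA_D, padD_D]

/-- `{Yᵢ, d} = ∂ᵢ(d) Yᵢ`. -/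
theorem pad_Y_D (i : Fin n) (d : D) : pad K (Y G i) (ι G d) = ι G (G.der i d) * Y G i := by
  change padA G _ _ = _
  rw [padA_Y, padY_D]

/-- `{Xᵢ, d} = -∂ᵢ(d) Xᵢ`. -/
theorem pad_X_D (i : Fin n) (d : D) : pad K (X G i) (ι G d) = -(ι G (G.der i d) * X G i) := by
  change padA G _ _ = _
  rw [padA_X, padX_D]

/-- `{Yᵢ, Xᵢ} = ∂ᵢ(aᵢ)`. -/
theorem pad_Y_X (i : Fin n) : pad K (Y G i) (X G i) = ι G (G.der i (G.a i)) := by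
  change padA G _ _ = _
  rw [padA_Y_X, if_pos rfl]

/-- `{Xᵢ, Yⱼ} = 0` for `i ≠ j`. -/
theorem pad_X_Y_of_ne {i j : Fin n} (h : i ≠ j) : pad K (X G i) (Y G j) = 0 := by
  change padA G _ _ = _
  rw [padA_X_Y, if_neg h.symm]

/-- `{Xᵢ, Xⱼ} = 0`. -/
theorem pad_X_X (i j : Fin n) : pad K (X G i) (X G j) = 0 := padA_X_X G i j

/-- `{Yᵢ, Yⱼ} = 0`. -/
theorem pad_Y_Y (i j : Fin n) : pad K (Y G i) (Y G j) = 0 := padA_Y_Y G i j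

end Bracket

end GWPA

end

/-! Simplicity of `diffOp K P` is the same as Poisson simplicity of `P`. Commutators with
multiplications lower the order of a differential operator, so a nonzero two-sided ideal contains
multiplication by some nonzero element (`exists_mulOp_mem`), and the elements obtained in this way
form a Poisson ideal. Conversely, the operators with image in a Poisson ideal form a two-sided
ideal. It remains to decide when `A` is Poisson simple.

Necessity: a `∂`-invariant Poisson ideal of `D` generates a Poisson ideal of `A`; the elements `Xᵢ,
Yᵢ, aᵢ, ∂ᵢ(aᵢ)` also generate one; a Poisson central element generates one as well. Explicit ring
maps out of `A` show that the first two kinds of ideal are proper unless the corresponding ideal of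
`D` is the unit ideal.

The centre: `A` is free over `D` on monomials `v_α`, `α ∈ ℤⁿ`, and brackets with `d`, `Xᵢ`, `Yᵢ`
shift the degree by `0`, `eᵢ`, `-eᵢ`. Hence the centre is graded, with component `D_α v_α` in degree
`α` (`coeff_mem_weight`, `term_mem_center`). If it is a field, then no nonzero `z = λ v_α` with `α ≠
0` can be central: `z` and `1 - z` would both be units, but some point over an algebraically closed
field sends `z` to `1`. For `n ≥ 1` characteristic zero follows, since `m = 0` in `K` puts `1` into
`D_{m e₁}`.

Sufficiency for `n ≥ 1`: in characteristic zero condition (a) makes `D` a domain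
(`isDomain_of_differentially_simple`), and (b) makes every `aᵢ` nonzero. Multiplying by a large
`v_γ` moves a nonzero element of a Poisson ideal into nonnegative degrees without killing it. In a
support of minimal size, taken up to translation, (a) allows one coefficient to be normalised to
`1`. Bracketing then kills that coefficient, so by minimality it kills all of them, which says that
the coefficient at `β` lies in `D_{β-β₀} = 0`. What remains is a single `v_γ`, and (b) lowers it
step by step to `1` (`eq_top_of_v_mem`). -/

namespace PoissonAlgebra

/-! ### Order of differential operators; simplicity of `diffOp` versus Poisson simplicity. -/

section DiffOp

variable {K P : Type*} [CommRing K] [CommRing P] [Algebra K P]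

/-- `f` is a differential operator on `P` of order less than `k`: all `k`-fold iterated commutators
of `f` with multiplications by elements of `P` vanish. -/
def HasOrderLT : ℕ → Module.End K P → Prop
  | 0, f => f = 0
  | k + 1, f => ∀ x : P, HasOrderLT k (f * LinearMap.mulLeft K x - LinearMap.mulLeft K x * f)

theorem HasOrderLT.zero : ∀ k, HasOrderLT k (0 : Module.End K P)
  | 0 => rfl
  | k + 1 => fun x => by simpa using HasOrderLT.zero k

theorem HasOrderLT.add {k : ℕ} {f g : Module.End K P} (hf : HasOrderLT k f)
    (hg : HasOrderLT k g) : HasOrderLT k (f + g) := by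
  induction k generalizing f g with
  | zero => rw [HasOrderLT] at *; rw [hf, hg, add_zero]
  | succ k ih =>
    intro x
    have := ih (hf x) (hg x)
    convert this using 1
    noncomm_ring

theorem HasOrderLT.succ {k : ℕ} {f : Module.End K P} (hf : HasOrderLT k f) :
    HasOrderLT (k + 1) f := by
  induction k generalizing f with
  | zero => rw [HasOrderLT] at hf; rw [hf]; exact HasOrderLT.zero _
  | succ k ih => exact fun x => ih (hf x)

theorem HasOrderLT.mono {k l : ℕ} (h : k ≤ l) {f : Module.End K P} (hf : HasOrderLT k f) :
    HasOrderLT l f := by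
  induction l, h using Nat.le_induction with
  | base => exact hf
  | succ l _ ih => exact ih.succ

/-- Commutation with a multiplication is a derivation, `[fg, x] = f[g, x] + [f, x]g`, and both
summands fall under the induction on `j + k`. The bound is not sharp; only its existence matters. -/
theorem HasOrderLT.mul {j k : ℕ} {f g : Module.End K P} (hf : HasOrderLT j f)
    (hg : HasOrderLT k g) : HasOrderLT (j + k) (f * g) := by
  induction h : j + k generalizing j k f g with
  | zero =>
    obtain ⟨rfl, rfl⟩ : j = 0 ∧ k = 0 := by omega
    rw [HasOrderLT] at *; rw [hf, zero_mul]
  | succ m ih =>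
    rcases j with _ | j
    · rw [HasOrderLT] at hf; rw [hf, zero_mul]; exact HasOrderLT.zero _
    rcases k with _ | k
    · rw [HasOrderLT] at hg; rw [hg, mul_zero]; exact HasOrderLT.zero _
    intro x
    have h1 := ih hf (hg x) (by omega)
    have h2 := ih (hf x) hg (by omega)
    convert h1.add h2 using 1
    simp only [mul_sub, sub_mul, mul_assoc]
    abel

theorem HasOrderLT.mulLeft (x : P) : HasOrderLT 1 (LinearMap.mulLeft K x) := by
  intro y
  ext z
  simp only [LinearMap.sub_apply, Module.End.mul_apply, LinearMap.mulLeft_apply,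
    LinearMap.zero_apply]
  ring

theorem HasOrderLT.derivation (δ : Derivation K P P) :
    HasOrderLT 2 (δ : P →ₗ[K] P) := by
  intro y
  have h : (δ : P →ₗ[K] P) * LinearMap.mulLeft K y - LinearMap.mulLeft K y * (δ : P →ₗ[K] P) =
      LinearMap.mulLeft K (δ y) := by
    ext z
    simp
    ring
  rw [h]
  exact HasOrderLT.mulLeft _

/-- By `P`-linearity, `f y = f (y · 1) = y f 1`. -/
theorem eq_mulLeft_of_commute {f : Module.End K P}
    (h : ∀ x, f * LinearMap.mulLeft K x - LinearMap.mulLeft K x * f = 0) :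
    f = LinearMap.mulLeft K (f 1) := by
  ext y
  have := LinearMap.congr_fun (h y) 1
  simp only [LinearMap.sub_apply, Module.End.mul_apply, LinearMap.mulLeft_apply,
    LinearMap.zero_apply, mul_one, sub_eq_zero] at this
  rw [this, LinearMap.mulLeft_apply, mul_comm]

variable [PoissonAlgebra K P]

theorem mulLeft_mem_diffOp (x : P) : LinearMap.mulLeft K x ∈ diffOp K P :=
  Algebra.subset_adjoin (Or.inl ⟨x, rfl⟩)

theorem pad_mem_diffOp (x : P) : (pad K x : P →ₗ[K] P) ∈ diffOp K P :=
  Algebra.subset_adjoin (Or.inr ⟨x, rfl⟩)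

theorem exists_hasOrderLT {f : Module.End K P} (hf : f ∈ diffOp K P) : ∃ k, HasOrderLT k f := by
  refine Algebra.adjoin_induction (fun f hf => ?_) (fun r => ?_) (fun f g _ _ hf hg => ?_)
    (fun f g _ _ hf hg => ?_) hf
  · rcases hf with ⟨x, rfl⟩ | ⟨x, rfl⟩
    · exact ⟨1, HasOrderLT.mulLeft x⟩
    · exact ⟨2, HasOrderLT.derivation _⟩
  · refine ⟨1, ?_⟩
    have h : algebraMap K (Module.End K P) r = LinearMap.mulLeft K (algebraMap K P r) := by
      ext y
      simp [Algebra.smul_def]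
    rw [h]
    exact HasOrderLT.mulLeft _
  · obtain ⟨j, hj⟩ := hf
    obtain ⟨k, hk⟩ := hg
    exact ⟨max j k, (hj.mono (le_max_left _ _)).add (hk.mono (le_max_right _ _))⟩
  · obtain ⟨j, hj⟩ := hf
    obtain ⟨k, hk⟩ := hg
    exact ⟨j + k, hj.mul hk⟩

variable (K P) in
/-- `P` is Poisson simple: it is nonzero and has no Poisson ideals except `0` and `P`. -/
def IsPoissonSimple : Prop :=
  Nontrivial P ∧ ∀ I : Ideal P, IsPoissonIdeal K I → I = ⊥ ∨ I = ⊤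

/-- Multiplication by `x ∈ P` as an element of `PD(P)`. -/
def mulOp (x : P) : diffOp K P := ⟨LinearMap.mulLeft K x, mulLeft_mem_diffOp x⟩

theorem mulOp_add (x y : P) : mulOp (K := K) (x + y) = mulOp x + mulOp y := by
  ext z; simp [mulOp, add_mul]

theorem mulOp_mul (x y : P) : mulOp (K := K) (x * y) = mulOp x * mulOp y := by
  ext z; simp [mulOp]

theorem mulOp_zero : mulOp (K := K) (0 : P) = 0 := by
  ext z; simp [mulOp]

theorem mulOp_one : mulOp (K := K) (1 : P) = 1 := by
  ext z; simp [mulOp]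

theorem mulOp_ne_zero {x : P} (hx : x ≠ 0) : mulOp (K := K) x ≠ 0 := fun h => hx <| by
  simpa [mulOp] using LinearMap.congr_fun (congrArg Subtype.val h) 1

/-- The Leibniz rule as a commutator identity; it makes the trace on `P` of a two-sided ideal closed
under the bracket. -/
theorem mulOp_pad (x y : P) : mulOp (pad K x y) =
    ⟨(pad K x : P →ₗ[K] P), pad_mem_diffOp x⟩ * mulOp y -
      mulOp y * ⟨(pad K x : P →ₗ[K] P), pad_mem_diffOp x⟩ := by
  ext z
  simp [mulOp]
  ring

/-- Commutators with multiplications stay in `J` and lower the order. As long as some commutator is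
nonzero, replace `f` by it; when all vanish, `f` is itself a multiplication. -/
theorem exists_mulOp_mem (J : TwoSidedIdeal (diffOp K P)) {f : diffOp K P} (hf : f ∈ J)
    (h0 : f ≠ 0) : ∃ x : P, x ≠ 0 ∧ mulOp x ∈ J := by
  obtain ⟨k, hk⟩ := exists_hasOrderLT f.2
  induction k generalizing f with
  | zero => rw [HasOrderLT] at hk; exact absurd (Subtype.ext hk) h0
  | succ k ih =>
    by_cases h : ∀ x, (f : Module.End K P) * LinearMap.mulLeft K x -
        LinearMap.mulLeft K x * (f : Module.End K P) = 0
    · have hf' : f = mulOp ((f : Module.End K P) 1) := Subtype.ext (eq_mulLeft_of_commute h)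
      refine ⟨(f : Module.End K P) 1, fun h1 => h0 ?_, hf' ▸ hf⟩
      rw [hf', h1, mulOp_zero]
    · push Not at h
      obtain ⟨x, hx⟩ := h
      exact ih (f := f * mulOp x - mulOp x * f)
        (J.sub_mem (J.mul_mem_right _ _ hf) (J.mul_mem_left _ _ hf))
        (fun h => hx (congrArg Subtype.val h)) (hk x)

theorem IsPoissonIdeal.apply_mem {I : Ideal P} (hI : IsPoissonIdeal K I) {f : Module.End K P}
    (hf : f ∈ diffOp K P) : ∀ x ∈ I, f x ∈ I := by
  refine Algebra.adjoin_induction (p := fun f _ => ∀ x ∈ I, f x ∈ I) (fun f hf => ?_)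
    (fun r x hx => ?_) (fun f g _ _ hf hg x hx => ?_) (fun f g _ _ hf hg x hx => ?_) hf
  · rcases hf with ⟨x, rfl⟩ | ⟨x, rfl⟩
    · exact fun y hy => I.mul_mem_left _ hy
    · exact hI x
  · rw [Module.algebraMap_end_apply]
    exact I.smul_of_tower_mem r hx
  · exact I.add_mem (hf x hx) (hg x hx)
  · exact hf _ (hg x hx)

/-- The algebra of Poisson differential operators is simple if and only if the Poisson algebra
is Poisson simple. -/
theorem isSimpleRing_diffOp_iff : IsSimpleRing (diffOp K P) ↔ IsPoissonSimple K P := by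
  constructor
  · intro h
    have hP : Nontrivial P := by
      by_contra hP
      rw [not_nontrivial_iff_subsingleton] at hP
      refine zero_ne_one (α := diffOp K P) ?_
      ext z
      exact Subsingleton.elim _ _
    refine ⟨hP, fun I hI => or_iff_not_imp_left.2 fun hI0 => ?_⟩
    obtain ⟨x, hx, hx0⟩ := Submodule.exists_mem_ne_zero_of_ne_bot hI0
    -- The operators with image in `I`: a left ideal because `I` is stable under `diffOp`, and a
    -- right ideal for any `I`. If it contains the identity, then `1 ∈ I`.
    let J : TwoSidedIdeal (diffOp K P) := TwoSidedIdeal.mk' {f | ∀ y, (f : Module.End K P) y ∈ I}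
      (fun y => I.zero_mem) (fun hf hg y => I.add_mem (hf y) (hg y)) (fun hf y => I.neg_mem (hf y))
      (fun {f g} hg y => hI.apply_mem f.2 _ (hg y)) (fun hf y => hf _)
    have hJ : mulOp x ∈ J := by
      rw [TwoSidedIdeal.mem_mk']
      exact fun y => I.mul_mem_right _ hx
    have h1 := IsSimpleRing.one_mem_of_ne_zero_mem J (mulOp_ne_zero hx0) hJ
    rw [TwoSidedIdeal.mem_mk'] at h1
    exact (Ideal.eq_top_iff_one I).2 (h1 1)
  · rintro ⟨hP, hI⟩
    have : Nontrivial (diffOp K P) := ⟨⟨mulOp 1, 0, mulOp_ne_zero one_ne_zero⟩⟩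
    refine IsSimpleRing.of_eq_bot_or_eq_top fun J => or_iff_not_imp_left.2 fun hJ => ?_
    obtain ⟨f, hf, hf0⟩ : ∃ f ∈ J, f ≠ 0 := by
      by_contra! h
      exact hJ (le_bot_iff.1 fun f hf => (TwoSidedIdeal.mem_bot _).2 (h f hf))
    obtain ⟨x, hx0, hx⟩ := exists_mulOp_mem J hf hf0
    let I : Ideal P :=
      { carrier := {x | mulOp x ∈ J}
        add_mem' := fun {x y} hx hy => by
          rw [Set.mem_ofPred_eq, mulOp_add]; exact J.add_mem hx hy
        zero_mem' := by rw [Set.mem_ofPred_eq, mulOp_zero]; exact J.zero_mem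
        smul_mem' := fun x y hy => by
          rw [Set.mem_ofPred_eq, smul_eq_mul, mulOp_mul]; exact J.mul_mem_left _ _ hy }
    have hIP : IsPoissonIdeal K I := fun x y hy => by
      change mulOp _ ∈ J
      rw [mulOp_pad]
      exact J.sub_mem (J.mul_mem_left _ _ hy) (J.mul_mem_right _ _ hy)
    rcases hI I hIP with h | h
    · exact absurd ((Submodule.mem_bot P).1 (h ▸ (show x ∈ I from hx))) hx0
    · have h1 : mulOp 1 ∈ J := (Ideal.eq_top_iff_one I).1 h
      rwa [mulOp_one, TwoSidedIdeal.one_mem_iff] at h1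

end DiffOp

/-! ### Principal Poisson ideals and the Poisson centre. -/

section Simple

variable {K P : Type*} [CommRing K] [CommRing P] [Algebra K P] [PoissonAlgebra K P]

theorem pad_center {z : P} (hz : z ∈ center K P) (x : P) : pad K x z = 0 := by
  rw [pad_skew, hz x, neg_zero]

/-- An ideal generated by `s` is Poisson as soon as `{x, y}` belongs to it for all `x` and
all `y ∈ s`. -/
theorem isPoissonIdeal_span {s : Set P} (h : ∀ x, ∀ y ∈ s, pad K x y ∈ Ideal.span s) :
    IsPoissonIdeal K (Ideal.span s) := by
  intro x y hy
  induction hy using Submodule.span_induction with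
  | mem y hy => exact h x y hy
  | zero => simp
  | add y z _ _ hy hz => rw [map_add]; exact Ideal.add_mem _ hy hz
  | smul r y hy' hy =>
    rw [smul_eq_mul, Derivation.leibniz]
    exact Ideal.add_mem _ (Ideal.mul_mem_left _ _ hy)
      (by rw [smul_eq_mul]; exact Ideal.mul_mem_right _ _ hy')

/-- The Poisson centre of a Poisson simple algebra is a field. -/
theorem IsPoissonSimple.isField_center (h : IsPoissonSimple K P) : IsField (center K P) := by
  obtain ⟨hP, hI⟩ := h
  refine ⟨⟨0, 1, zero_ne_one⟩, mul_comm, fun {z} hz => ?_⟩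
  have hz0 : (z : P) ≠ 0 := fun h => hz (Subtype.ext h)
  have hzI : IsPoissonIdeal K (Ideal.span {(z : P)}) := isPoissonIdeal_span fun x y hy => by
    rw [Set.mem_singleton_iff] at hy
    rw [hy, pad_center z.2]
    exact Ideal.zero_mem _
  have htop := (hI _ hzI).resolve_left fun h => hz0 (Ideal.span_singleton_eq_bot.1 h)
  obtain ⟨w, hw⟩ := (Ideal.span_singleton_eq_top.1 htop).exists_right_inv
  -- The inverse is central: applying `{x, ·}` to `zw = 1` gives `z{x, w} = 0`, and `z` is a unit.
  refine ⟨⟨w, fun x => ?_⟩, Subtype.ext hw⟩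
  have h1 : pad K x ((z : P) * w) = 0 := by rw [hw]; simp
  rw [Derivation.leibniz, pad_center z.2, smul_zero, add_zero, smul_eq_mul] at h1
  rw [pad_skew, ← one_mul (pad K x w), ← hw, mul_comm (z : P) w, mul_assoc, h1, mul_zero, neg_zero]

end Simple

end PoissonAlgebra

/-! ### Differentially simple rings in characteristic zero. -/

/-- A nonzero commutative `ℚ`-algebra without nontrivial ideals invariant under a given set of
derivations is a domain. -/
theorem isDomain_of_differentially_simple {K R : Type*} [Field K] [CharZero K] [CommRing R]
    [Algebra K R] [Nontrivial R] (S : Set (Derivation K R R))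
    (h : ∀ I : Ideal R, (∀ δ ∈ S, ∀ x ∈ I, δ x ∈ I) → I = ⊥ ∨ I = ⊤) : IsDomain R := by
  -- At `j = m` this reads `δ(x)^(2m) = 0`, so the nilradical is stable under `δ`. To pass from `j`
  -- to `j + 1`, differentiate the relation and multiply by `δ x`: the term containing `δ (δ x)` is
  -- a multiple of the old relation, and the other one is the new relation times `m - j`, which is
  -- invertible.
  have hpow (δ : Derivation K R R) (x : R) (m : ℕ) (hx : x ^ m = 0) :
      ∀ j ≤ m, x ^ (m - j) * δ x ^ (2 * j) = 0 := by
    intro j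
    induction j with
    | zero => intro _; simpa using hx
    | succ j ih =>
      intro hj
      obtain ⟨r, rfl⟩ : ∃ r, m = j + 1 + r := ⟨m - (j + 1), by omega⟩
      have h1 := ih (by omega)
      rw [show j + 1 + r - j = r + 1 by omega] at h1
      rw [show j + 1 + r - (j + 1) = r by omega]
      have h2 := congrArg (fun y => δ x * δ y) h1
      simp only [Derivation.leibniz, Derivation.leibniz_pow, map_zero, smul_eq_mul, nsmul_eq_mul,
        mul_zero, Nat.add_sub_cancel] at h2
      have h3 : ((r + 1 : ℕ) : R) * (x ^ r * δ x ^ (2 * (j + 1))) = 0 := by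
        -- For `j = 0` the truncated exponent `2 * j - 1` is harmless, because its term carries the
        -- coefficient `0`.
        rcases j with _ | j
        · simp only [mul_zero, pow_zero, Nat.cast_zero, zero_mul, zero_add, mul_one] at h1 h2 ⊢
          linear_combination h2
        · rw [show 2 * (j + 1) - 1 = 2 * j + 1 by omega] at h2
          linear_combination h2 - (((2 * (j + 1) : ℕ) : R) * δ (δ x)) * h1
      have hu : IsUnit ((r + 1 : ℕ) : R) := by
        rw [← map_natCast (algebraMap K R)]
        exact (IsUnit.mk0 _ (Nat.cast_ne_zero.2 (Nat.succ_ne_zero r))).map _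
      exact hu.mul_right_eq_zero.1 h3
  have hred : IsReduced R := by
    have hnil : nilradical R = ⊥ := by
      refine (h (nilradical R) fun δ _ x hx => ?_).resolve_right fun htop => ?_
      · obtain ⟨m, hm⟩ := mem_nilradical.1 hx
        refine mem_nilradical.2 ⟨2 * m, ?_⟩
        simpa using hpow δ x m hm m le_rfl
      · have h1 : (1 : R) ∈ nilradical R := htop ▸ Submodule.mem_top
        exact not_isNilpotent_one (mem_nilradical.1 h1)
    exact nilradical_eq_bot_iff.1 hnil
  have hdom : NoZeroDivisors R := by
    refine ⟨fun {x y} hxy => or_iff_not_imp_left.2 fun hx => ?_⟩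
    -- The annihilator of `x`. From `x w = 0` one gets `x δ(w) = -w δ(x)`, hence `(x δ(w))² = 0`,
    -- and reducedness shows that this ideal is stable under `δ`.
    let I : Ideal R :=
      { carrier := {w | x * w = 0}
        add_mem' := fun {v w} hv hw => by
          rw [Set.mem_ofPred_eq] at *; rw [mul_add, hv, hw, add_zero]
        zero_mem' := mul_zero _
        smul_mem' := fun r w hw => by
          rw [Set.mem_ofPred_eq] at *; rw [smul_eq_mul, mul_left_comm, hw, mul_zero] }
    have hI : I = ⊥ := by
      refine (h I fun δ _ w hw => ?_).resolve_right fun htop => hx ?_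
      · change x * δ w = 0
        have hw' : x * w = 0 := hw
        have h1 := congrArg δ hw'
        rw [Derivation.leibniz, map_zero, smul_eq_mul, smul_eq_mul] at h1
        refine pow_eq_zero_iff two_ne_zero |>.1 ?_
        linear_combination (x * δ w) * h1 - δ w * δ x * hw'
      · have h1 : (1 : R) ∈ I := htop ▸ Submodule.mem_top
        simpa using (show x * 1 = 0 from h1)
    exact (Submodule.mem_bot R).1 (hI ▸ (show y ∈ I from hxy))
  exact NoZeroDivisors.to_isDomain R

/-! ### Ring maps out of `A`, and the necessity of conditions (a) and (b). -/

namespace GWPA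

open PoissonAlgebra

variable {K D : Type*} [CommRing K] [CommRing D] [Algebra K D] [PoissonAlgebra K D] {n : ℕ}
variable {G : GWPAData K D n}

theorem exists_lift {R : Type*} [CommRing R] (f : D →+* R) (x y : Fin n → R)
    (h : ∀ i, x i * y i = f (G.a i)) : ∃ φ : GWPA G →+* R,
      (∀ d, φ (ι G d) = f d) ∧ (∀ i, φ (X G i) = x i) ∧ (∀ i, φ (Y G i) = y i) := by
  let φ₀ : MvPolynomial (Fin n ⊕ Fin n) D →+* R := MvPolynomial.eval₂Hom f (Sum.elim x y)
  have h₀ : Ideal.span (Set.range fun i : Fin n =>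
      (MvPolynomial.X (Sum.inl i) * MvPolynomial.X (Sum.inr i) - MvPolynomial.C (G.a i) :
        MvPolynomial (Fin n ⊕ Fin n) D)) ≤ RingHom.ker φ₀ := by
    rw [Ideal.span_le]
    rintro _ ⟨i, rfl⟩
    rw [SetLike.mem_coe, RingHom.mem_ker]
    simp [φ₀, h]
  refine ⟨Ideal.Quotient.lift _ φ₀ fun z hz => h₀ hz, fun d => ?_, fun i => ?_, fun i => ?_⟩
  · change φ₀ (MvPolynomial.C d) = _
    simp [φ₀]
  · change φ₀ (MvPolynomial.X _) = _
    simp [φ₀]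
  · change φ₀ (MvPolynomial.X _) = _
    simp [φ₀]

/-- The ring homomorphism `A → R` with prescribed values on `D`, the `Xᵢ` and the `Yᵢ`. -/
noncomputable def lift {R : Type*} [CommRing R] (f : D →+* R) (x y : Fin n → R)
    (h : ∀ i, x i * y i = f (G.a i)) : GWPA G →+* R := (exists_lift f x y h).choose

section Lift

variable {R : Type*} [CommRing R] (f : D →+* R) (x y : Fin n → R)
  (h : ∀ i, x i * y i = f (G.a i))

theorem lift_D (d : D) : lift f x y h (ι G d) = f d := (exists_lift f x y h).choose_spec.1 d

theorem lift_X (i : Fin n) : lift f x y h (X G i) = x i :=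
  (exists_lift f x y h).choose_spec.2.1 i

theorem lift_Y (i : Fin n) : lift f x y h (Y G i) = y i :=
  (exists_lift f x y h).choose_spec.2.2 i

end Lift

/-- The ring map `Xᵢ ↦ 1`, `Yᵢ ↦ aᵢ` is a retraction of `A` onto `D`. -/
theorem ι_injective : Function.Injective (ι G) := fun d e h => by
  have := congrArg (lift (RingHom.id D) (fun _ => 1) G.a (fun i => by simp)) h
  rwa [lift_D, lift_D] at this

theorem X_ne_zero [Nontrivial D] (i : Fin n) : X G i ≠ 0 := fun h => by
  have := congrArg (lift (RingHom.id D) (fun _ => 1) G.a (fun i => by simp)) h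
  rw [lift_X, map_zero] at this
  exact one_ne_zero this

theorem pad_D_X (d : D) (i : Fin n) : pad K (ι G d) (X G i) = ι G (G.der i d) * X G i := by
  rw [pad_skew, pad_X_D, neg_neg]

theorem pad_D_Y (d : D) (i : Fin n) : pad K (ι G d) (Y G i) = -(ι G (G.der i d) * Y G i) := by
  rw [pad_skew, pad_Y_D]

theorem pad_X_Y (i : Fin n) : pad K (X G i) (Y G i) = -ι G (G.der i (G.a i)) := by
  rw [pad_skew, pad_Y_X]

theorem pad_Y_X_of_ne {i j : Fin n} (h : i ≠ j) : pad K (Y G i) (X G j) = 0 := by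
  rw [pad_skew, pad_X_Y_of_ne G h.symm, neg_zero]

/-- The bracket is a derivation in its first argument too, so only generators of `A` need testing
there. -/
theorem isPoissonIdeal_span {s : Set (GWPA G)}
    (hD : ∀ d, ∀ y ∈ s, pad K (ι G d) y ∈ Ideal.span s)
    (hX : ∀ i, ∀ y ∈ s, pad K (X G i) y ∈ Ideal.span s)
    (hY : ∀ i, ∀ y ∈ s, pad K (Y G i) y ∈ Ideal.span s) :
    IsPoissonIdeal K (Ideal.span s) := by
  refine PoissonAlgebra.isPoissonIdeal_span fun x y hy => ?_
  refine induction (p := fun x => pad K x y ∈ Ideal.span s) (fun d => hD d y hy)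
    (fun i => hX i y hy) (fun i => hY i y hy) (fun x x' hx hx' => ?_) (fun x x' hx hx' => ?_) x
  · rw [pad_add_left, Derivation.add_apply]
    exact Ideal.add_mem _ hx hx'
  · rw [pad_mul_left, Derivation.add_apply]
    exact Ideal.add_mem _ (Ideal.mul_mem_left _ _ hx') (Ideal.mul_mem_left _ _ hx)

/-- If `A` is Poisson simple then `D` has no nontrivial `∂`-invariant Poisson ideals. -/
theorem eq_bot_or_eq_top_of_isPoissonSimple (h : IsPoissonSimple K (GWPA G)) (I : Ideal D)
    (hI : IsPoissonIdeal K I) (hI' : G.IsInvariant I) : I = ⊥ ∨ I = ⊤ := by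
  have hs : IsPoissonIdeal K (Ideal.span (ι G '' (I : Set D))) := by
    refine isPoissonIdeal_span ?_ ?_ ?_
    · rintro d _ ⟨x, hx, rfl⟩
      rw [pad_D_D]
      exact Ideal.subset_span ⟨_, hI d x hx, rfl⟩
    · rintro i _ ⟨x, hx, rfl⟩
      rw [pad_X_D]
      exact neg_mem (Ideal.mul_mem_right _ _ (Ideal.subset_span ⟨_, hI' i x hx, rfl⟩))
    · rintro i _ ⟨x, hx, rfl⟩
      rw [pad_Y_D]
      exact Ideal.mul_mem_right _ _ (Ideal.subset_span ⟨_, hI' i x hx, rfl⟩)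
  rcases h.2 _ hs with h0 | h1
  · left
    refine (Submodule.eq_bot_iff I).2 fun x hx => ?_
    have hx' : ι G x ∈ (⊥ : Ideal (GWPA G)) := h0 ▸ Ideal.subset_span ⟨x, hx, rfl⟩
    exact ι_injective (by rw [(Submodule.mem_bot _).1 hx']; exact (map_zero _).symm)
  · right
    -- This map kills the ideal generated by `I`; if that ideal is all of `A`, then `1 = 0` in `D ⧸
    -- I`.
    let φ : GWPA G →+* D ⧸ I := lift (Ideal.Quotient.mk I) (fun _ => 1)
      (fun i => Ideal.Quotient.mk I (G.a i)) (fun i => by simp)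
    have hφ : Ideal.span (ι G '' (I : Set D)) ≤ RingHom.ker φ := by
      rw [Ideal.span_le]
      rintro _ ⟨x, hx, rfl⟩
      rw [SetLike.mem_coe, RingHom.mem_ker, lift_D]
      exact Ideal.Quotient.eq_zero_iff_mem.2 hx
    have h2 : (1 : GWPA G) ∈ RingHom.ker φ := hφ (h1 ▸ Submodule.mem_top)
    rw [RingHom.mem_ker, map_one] at h2
    exact (Ideal.eq_top_iff_one I).2
      (Ideal.Quotient.eq_zero_iff_mem.1 (by rw [map_one]; exact h2))

/-- If `A` is Poisson simple then `aᵢ` and `∂ᵢ(aᵢ)` generate the unit ideal of `D`. -/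
theorem span_sup_span_eq_top_of_isPoissonSimple (h : IsPoissonSimple K (GWPA G)) (i : Fin n) :
    Ideal.span {G.a i} ⊔ Ideal.span {G.der i (G.a i)} = ⊤ := by
  -- The bracket `{Yᵢ, Xᵢ}` forces `∂ᵢ(aᵢ)` into any Poisson ideal containing `Xᵢ`, and `XᵢYᵢ`
  -- forces `aᵢ`. These four elements already generate a Poisson ideal.
  let s : Set (GWPA G) := {X G i, Y G i, ι G (G.a i), ι G (G.der i (G.a i))}
  have hXs : X G i ∈ Ideal.span s := Ideal.subset_span (by simp [s])
  have hYs : Y G i ∈ Ideal.span s := Ideal.subset_span (by simp [s])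
  have has : ι G (G.der i (G.a i)) ∈ Ideal.span s := Ideal.subset_span (by simp [s])
  have hs : IsPoissonIdeal K (Ideal.span s) := by
    refine isPoissonIdeal_span ?_ ?_ ?_
    · rintro d _ (rfl | rfl | rfl | rfl)
      · rw [pad_D_X]; exact Ideal.mul_mem_left _ _ hXs
      · rw [pad_D_Y]; exact neg_mem (Ideal.mul_mem_left _ _ hYs)
      · rw [pad_D_D, pad_center (G.a_mem i)]; simp [ι]
      · rw [pad_D_D, pad_der_a]; simp [ι]
    · rintro j _ (rfl | rfl | rfl | rfl)
      · rw [pad_X_X]; exact Ideal.zero_mem _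
      · rcases eq_or_ne j i with rfl | hj
        · rw [pad_X_Y]; exact neg_mem has
        · rw [pad_X_Y_of_ne G hj]; exact Ideal.zero_mem _
      · rw [pad_X_D]
        rcases eq_or_ne j i with rfl | hj
        · exact neg_mem (Ideal.mul_mem_left _ _ hXs)
        · rw [G.der_a j i hj]; simp [ι]
      · rw [pad_X_D]
        rcases eq_or_ne j i with rfl | hj
        · exact neg_mem (Ideal.mul_mem_left _ _ hXs)
        · rw [der_der_a G i j hj.symm]; simp [ι]
    · rintro j _ (rfl | rfl | rfl | rfl)
      · rcases eq_or_ne j i with rfl | hj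
        · rw [pad_Y_X]; exact has
        · rw [pad_Y_X_of_ne hj]; exact Ideal.zero_mem _
      · rw [pad_Y_Y]; exact Ideal.zero_mem _
      · rw [pad_Y_D]
        rcases eq_or_ne j i with rfl | hj
        · exact Ideal.mul_mem_left _ _ hYs
        · rw [G.der_a j i hj]; simp [ι]
      · rw [pad_Y_D]
        rcases eq_or_ne j i with rfl | hj
        · exact Ideal.mul_mem_left _ _ hYs
        · rw [der_der_a G i j hj.symm]; simp [ι]
  have hD : Nontrivial D := by
    have := h.1
    by_contra hD
    rw [not_nontrivial_iff_subsingleton] at hD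
    refine zero_ne_one (α := GWPA G) ?_
    rw [← map_one (algebraMap D (GWPA G)), ← map_zero (algebraMap D (GWPA G))]
    exact congrArg _ (Subsingleton.elim _ _)
  have htop := (h.2 _ hs).resolve_left fun h0 =>
    X_ne_zero (G := G) i ((Submodule.mem_bot _).1 (h0 ▸ hXs))
  set J : Ideal D := Ideal.span {G.a i} ⊔ Ideal.span {G.der i (G.a i)} with hJ
  have haJ : Ideal.Quotient.mk J (G.a i) = 0 := Ideal.Quotient.eq_zero_iff_mem.2
    (Ideal.mem_sup_left (Ideal.mem_span_singleton_self _))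
  have hdJ : Ideal.Quotient.mk J (G.der i (G.a i)) = 0 := Ideal.Quotient.eq_zero_iff_mem.2
    (Ideal.mem_sup_right (Ideal.mem_span_singleton_self _))
  -- Since `aᵢ` vanishes modulo `J`, both `Xᵢ` and `Yᵢ` go to `0`; thus `span s` is killed, and it
  -- can be the unit ideal only if `J` is.
  let φ : GWPA G →+* D ⧸ J := lift (Ideal.Quotient.mk J) (fun j => if j = i then 0 else 1)
      (fun j => Ideal.Quotient.mk J (G.a j)) (fun j => by
        rcases eq_or_ne j i with rfl | hj
        · simp [haJ]
        · simp [hj])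
  have hφ : Ideal.span s ≤ RingHom.ker φ := by
    rw [Ideal.span_le]
    rintro _ (rfl | rfl | rfl | rfl) <;> rw [SetLike.mem_coe, RingHom.mem_ker]
    · rw [lift_X, if_pos rfl]
    · rw [lift_Y, haJ]
    · rw [lift_D, haJ]
    · rw [lift_D, hdJ]
  have h2 : (1 : GWPA G) ∈ RingHom.ker φ := hφ (htop ▸ Submodule.mem_top)
  rw [RingHom.mem_ker, map_one] at h2
  exact (Ideal.eq_top_iff_one J).2
    (Ideal.Quotient.eq_zero_iff_mem.1 (by rw [map_one]; exact h2))

end GWPA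

/-! ### The monomials `v_α` and the action of the generators on them. -/

namespace GWPA

open PoissonAlgebra

variable {K D : Type*} [CommRing K] [CommRing D] [Algebra K D] [PoissonAlgebra K D] {n : ℕ}
variable (G : GWPAData K D n)

/-- The element `Xᵢᵐ` for `m ≥ 0`, and `Yᵢ⁻ᵐ` for `m ≤ 0`. -/
noncomputable def w (i : Fin n) (m : ℤ) : GWPA G := X G i ^ m.toNat * Y G i ^ (-m).toNat

theorem w_natCast (i : Fin n) (m : ℕ) : w G i m = X G i ^ m := by
  simp [w]

theorem w_neg_natCast (i : Fin n) (m : ℕ) : w G i (-m) = Y G i ^ m := by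
  simp [w]

/-- The element `v_α = ∏ᵢ Xᵢ^αᵢ`, with `Yᵢ^(-αᵢ)` in place of `Xᵢ^αᵢ` if `αᵢ < 0`. -/
noncomputable def v (α : Fin n → ℤ) : GWPA G := ∏ i, w G i (α i)

theorem v_zero : v G 0 = 1 := by simp [v, w]

/-- The scalar `c` with `Xᵢ v_α = c v_(α + eᵢ)`, `αᵢ = m`. -/
noncomputable def upMul (i : Fin n) (m : ℤ) : D := if 0 ≤ m then 1 else G.a i

/-- The scalar `c` with `{Xᵢ, v_α} = c v_(α + eᵢ)`, `αᵢ = m`. -/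
noncomputable def upPad (i : Fin n) (m : ℤ) : D := if 0 ≤ m then 0 else m * G.der i (G.a i)

/-- The scalar `c` with `Yᵢ v_α = c v_(α - eᵢ)`, `αᵢ = m`. -/
noncomputable def downMul (i : Fin n) (m : ℤ) : D := if m ≤ 0 then 1 else G.a i

/-- The scalar `c` with `{Yᵢ, v_α} = c v_(α - eᵢ)`, `αᵢ = m`. -/
noncomputable def downPad (i : Fin n) (m : ℤ) : D := if m ≤ 0 then 0 else m * G.der i (G.a i)

theorem X_mul_w (i : Fin n) (m : ℤ) : X G i * w G i m = ι G (upMul G i m) * w G i (m + 1) := by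
  rcases m.eq_nat_or_neg with ⟨k, rfl | rfl⟩
  · rw [w_natCast, upMul, if_pos (by positivity), ← Nat.cast_succ, w_natCast]
    simp [ι, pow_succ']
  · rcases k with _ | k
    · simp [upMul, w]
    · rw [w_neg_natCast, upMul, if_neg (by push_cast; omega), ← X_mul_Y,
        show -((k + 1 : ℕ) : ℤ) + 1 = -(k : ℤ) by push_cast; ring, w_neg_natCast]
      ring

theorem Y_mul_w (i : Fin n) (m : ℤ) : Y G i * w G i m = ι G (downMul G i m) * w G i (m - 1) := by
  rcases m.eq_nat_or_neg with ⟨k, rfl | rfl⟩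
  · rcases k with _ | k
    · simp [downMul, w]
    · rw [w_natCast, downMul, if_neg (by push_cast; omega), ← X_mul_Y,
        show ((k + 1 : ℕ) : ℤ) - 1 = (k : ℤ) by push_cast; ring, w_natCast]
      ring
  · rw [w_neg_natCast, downMul, if_pos (by omega),
      show -(k : ℤ) - 1 = -((k + 1 : ℕ) : ℤ) by push_cast; ring, w_neg_natCast]
    simp [ι, pow_succ']

theorem pad_D_w (d : D) (i : Fin n) (m : ℤ) :
    pad K (ι G d) (w G i m) = ι G (m * G.der i d) * w G i m := by
  have hpow (x c : GWPA G) (h : pad K (ι G d) x = c * x) (k : ℕ) :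
      pad K (ι G d) (x ^ k) = k * c * x ^ k := by
    induction k with
    | zero => simp
    | succ k ih =>
      rw [pow_succ, Derivation.leibniz, ih, h]
      simp only [smul_eq_mul]; push_cast; ring
  rcases m.eq_nat_or_neg with ⟨k, rfl | rfl⟩
  · rw [w_natCast, hpow _ _ (pad_D_X d i)]
    simp [ι]
  · rw [w_neg_natCast, hpow _ (-ι G (G.der i d)) (by rw [pad_D_Y, neg_mul])]
    simp [ι]

theorem pad_X_w (i : Fin n) (m : ℤ) :
    pad K (X G i) (w G i m) = ι G (upPad G i m) * w G i (m + 1) := by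
  rcases m.eq_nat_or_neg with ⟨k, rfl | rfl⟩
  · rw [w_natCast, upPad, if_pos (by positivity), Derivation.leibniz_pow, pad_self]
    simp [ι]
  · rcases k with _ | k
    · simp [upPad, w, ι]
    · rw [w_neg_natCast, upPad, if_neg (by push_cast; omega), Derivation.leibniz_pow, pad_X_Y,
        show -((k + 1 : ℕ) : ℤ) + 1 = -(k : ℤ) by push_cast; ring, w_neg_natCast]
      simp [ι]
      ring

theorem pad_Y_w (i : Fin n) (m : ℤ) :
    pad K (Y G i) (w G i m) = ι G (downPad G i m) * w G i (m - 1) := by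
  rcases m.eq_nat_or_neg with ⟨k, rfl | rfl⟩
  · rcases k with _ | k
    · simp [downPad, w, ι]
    · rw [w_natCast, downPad, if_neg (by push_cast; omega), Derivation.leibniz_pow, pad_Y_X,
        show ((k + 1 : ℕ) : ℤ) - 1 = (k : ℤ) by push_cast; ring, w_natCast]
      simp [ι]
      ring
  · rw [w_neg_natCast, downPad, if_pos (by omega), Derivation.leibniz_pow, pad_self]
    simp [ι]

theorem pad_X_w_of_ne {i j : Fin n} (h : i ≠ j) (m : ℤ) : pad K (X G i) (w G j m) = 0 := by
  simp [w, Derivation.leibniz, Derivation.leibniz_pow, pad_X_X, pad_X_Y_of_ne G h]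

theorem pad_Y_w_of_ne {i j : Fin n} (h : i ≠ j) (m : ℤ) : pad K (Y G i) (w G j m) = 0 := by
  simp [w, Derivation.leibniz, Derivation.leibniz_pow, pad_Y_Y, pad_Y_X_of_ne h]

theorem v_eq_mul (i : Fin n) (α : Fin n → ℤ) :
    v G α = w G i (α i) * ∏ j ∈ Finset.univ.erase i, w G j (α j) :=
  (Finset.mul_prod_erase _ _ (Finset.mem_univ i)).symm

theorem v_add_single (i : Fin n) (α : Fin n → ℤ) (k : ℤ) :
    v G (α + Pi.single i k) = w G i (α i + k) * ∏ j ∈ Finset.univ.erase i, w G j (α j) := by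
  rw [v_eq_mul G i, Pi.add_apply, Pi.single_eq_same]
  congr 1
  refine Finset.prod_congr rfl fun j hj => ?_
  rw [Pi.add_apply, Pi.single_eq_of_ne (Finset.ne_of_mem_erase hj), add_zero]

theorem v_sub_single (i : Fin n) (α : Fin n → ℤ) :
    v G (α - Pi.single i 1) = w G i (α i - 1) * ∏ j ∈ Finset.univ.erase i, w G j (α j) := by
  rw [sub_eq_add_neg, ← Pi.single_neg, v_add_single, sub_eq_add_neg]

theorem derivation_prod_eq_zero (δ : Derivation K (GWPA G) (GWPA G)) {σ : Type*} (s : Finset σ)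
    (f : σ → GWPA G) (h : ∀ j ∈ s, δ (f j) = 0) : δ (∏ j ∈ s, f j) = 0 := by
  classical
  induction s using Finset.induction_on with
  | empty => simp
  | insert j s hj ih =>
    rw [Finset.prod_insert hj, Derivation.leibniz, h j (Finset.mem_insert_self _ _),
      ih fun k hk => h k (Finset.mem_insert_of_mem hk), smul_zero, smul_zero, add_zero]

theorem X_mul_v (i : Fin n) (α : Fin n → ℤ) :
    X G i * v G α = ι G (upMul G i (α i)) * v G (α + Pi.single i 1) := by
  rw [v_eq_mul G i, v_add_single, ← mul_assoc, X_mul_w, mul_assoc]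

theorem Y_mul_v (i : Fin n) (α : Fin n → ℤ) :
    Y G i * v G α = ι G (downMul G i (α i)) * v G (α - Pi.single i 1) := by
  rw [v_eq_mul G i, v_sub_single, ← mul_assoc, Y_mul_w, mul_assoc]

theorem pad_X_v (i : Fin n) (α : Fin n → ℤ) :
    pad K (X G i) (v G α) = ι G (upPad G i (α i)) * v G (α + Pi.single i 1) := by
  rw [v_eq_mul G i, v_add_single, Derivation.leibniz, pad_X_w, derivation_prod_eq_zero]
  · simp only [smul_eq_mul]; ring
  · exact fun j hj => pad_X_w_of_ne G (Finset.ne_of_mem_erase hj).symm _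

theorem pad_Y_v (i : Fin n) (α : Fin n → ℤ) :
    pad K (Y G i) (v G α) = ι G (downPad G i (α i)) * v G (α - Pi.single i 1) := by
  rw [v_eq_mul G i, v_sub_single, Derivation.leibniz, pad_Y_w, derivation_prod_eq_zero]
  · simp only [smul_eq_mul]; ring
  · exact fun j hj => pad_Y_w_of_ne G (Finset.ne_of_mem_erase hj).symm _

theorem pad_D_v (d : D) (α : Fin n → ℤ) :
    pad K (ι G d) (v G α) = ι G (∑ i, α i * G.der i d) * v G α := by
  have h (s : Finset (Fin n)) : pad K (ι G d) (∏ i ∈ s, w G i (α i)) =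
      ι G (∑ i ∈ s, α i * G.der i d) * ∏ i ∈ s, w G i (α i) := by
    induction s using Finset.induction_on with
    | empty => simp [ι]
    | insert j s hj ih =>
      rw [Finset.prod_insert hj, Finset.sum_insert hj, Derivation.leibniz, ih, pad_D_w]
      simp only [smul_eq_mul, ι, map_add]; ring
  exact h _

/-- This and the next two formulas show that the bracket is homogeneous for the `ℤⁿ`-grading. Their
coefficients are the source of the conditions that define `D_α`. -/
theorem pad_D_term (d l : D) (α : Fin n → ℤ) : pad K (ι G d) (ι G l * v G α) =
    ι G (pad K d l + l * ∑ i, α i * G.der i d) * v G α := by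
  rw [Derivation.leibniz, pad_D_v, pad_D_D]
  simp only [smul_eq_mul, ι, map_add, map_mul]; ring

theorem pad_X_term (i : Fin n) (l : D) (α : Fin n → ℤ) : pad K (X G i) (ι G l * v G α) =
    ι G (l * upPad G i (α i) - G.der i l * upMul G i (α i)) * v G (α + Pi.single i 1) := by
  rw [Derivation.leibniz, pad_X_v, pad_X_D]
  simp only [smul_eq_mul, ι, map_sub, map_mul]
  linear_combination -algebraMap D (GWPA G) (G.der i l) * X_mul_v G i α

theorem pad_Y_term (i : Fin n) (l : D) (α : Fin n → ℤ) : pad K (Y G i) (ι G l * v G α) =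
    ι G (l * downPad G i (α i) + G.der i l * downMul G i (α i)) * v G (α - Pi.single i 1) := by
  rw [Derivation.leibniz, pad_Y_v, pad_Y_D]
  simp only [smul_eq_mul, ι, map_add, map_mul]
  linear_combination algebraMap D (GWPA G) (G.der i l) * Y_mul_v G i α

/-- The elements `v_α` span `A` over `D`. -/
theorem exists_eq_sum (x : GWPA G) : ∃ f : (Fin n → ℤ) →₀ D, x = f.sum fun α l => ι G l * v G α := by
  classical
  have hadd (f g : (Fin n → ℤ) →₀ D) : (f + g).sum (fun α l => ι G l * v G α) =
      f.sum (fun α l => ι G l * v G α) + g.sum fun α l => ι G l * v G α :=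
    Finsupp.sum_add_index' (fun α => by simp [ι]) fun α l m => by simp [ι, add_mul]
  obtain ⟨p, rfl⟩ := mk_surjective G x
  induction p using MvPolynomial.induction_on with
  | C d =>
    refine ⟨Finsupp.single 0 d, ?_⟩
    rw [Finsupp.sum_single_index (by simp [ι]), v_zero, mul_one, mk_C]
  | add p q hp hq =>
    obtain ⟨f, hf⟩ := hp
    obtain ⟨g, hg⟩ := hq
    exact ⟨f + g, by rw [map_add, hf, hg, hadd]⟩
  | mul_X p i hp =>
    obtain ⟨f, hf⟩ := hp
    rw [map_mul, hf]
    clear hf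
    induction f using Finsupp.induction_linear with
    | zero => exact ⟨0, by simp⟩
    | add f g hf hg =>
      obtain ⟨f', hf⟩ := hf
      obtain ⟨g', hg⟩ := hg
      exact ⟨f' + g', by rw [hadd, hadd, add_mul, hf, hg]⟩
    | single α l =>
      rw [Finsupp.sum_single_index (by simp [ι])]
      rcases i with i | i
      · refine ⟨Finsupp.single (α + Pi.single i 1) (l * upMul G i (α i)), ?_⟩
        rw [Finsupp.sum_single_index (by simp [ι])]
        have := X_mul_v G i α
        simp only [ι, map_mul] at this ⊢
        rw [mul_assoc, mul_assoc, ← this, mul_comm (v G α)]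
        rfl
      · refine ⟨Finsupp.single (α - Pi.single i 1) (l * downMul G i (α i)), ?_⟩
        rw [Finsupp.sum_single_index (by simp [ι])]
        have := Y_mul_v G i α
        simp only [ι, map_mul] at this ⊢
        rw [mul_assoc, mul_assoc, ← this, mul_comm (v G α)]
        rfl

end GWPA

/-! ### Freeness of `A` over `D`, and the homogeneous components of the Poisson centre. -/

namespace GWPA

open PoissonAlgebra

variable {K D : Type*} [CommRing K] [CommRing D] [Algebra K D] [PoissonAlgebra K D] {n : ℕ}
variable (G : GWPAData K D n)

theorem term_induction {p : GWPA G → Prop} (h0 : p 0) (hadd : ∀ x y, p x → p y → p (x + y))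
    (hterm : ∀ l α, p (ι G l * v G α)) (x : GWPA G) : p x := by
  obtain ⟨f, rfl⟩ := exists_eq_sum G x
  exact Finset.sum_induction _ p hadd h0 fun α _ => hterm _ _

/-- For each `α`, a homomorphism `A → D[ℤⁿ]` which maps each `v_β` to a multiple of the monomial of
exponent `β`, and `v_α` to the monomial of exponent `α`. -/
noncomputable def toLaurent (α : Fin n → ℤ) : GWPA G →+* AddMonoidAlgebra D (Fin n → ℤ) :=
  lift AddMonoidAlgebra.singleZeroRingHom
    -- The factor `aᵢ` is put on whichever of `Xᵢ`, `Yᵢ` does not occur in `v_α`. Since `aᵢ` may be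
    -- a zero divisor, one fixed choice would not detect all coefficients.
    (fun i => AddMonoidAlgebra.single (Pi.single i 1) (if 0 ≤ α i then 1 else G.a i))
    (fun i => AddMonoidAlgebra.single (Pi.single i (-1)) (if 0 ≤ α i then G.a i else 1))
    (fun i => by
      rw [AddMonoidAlgebra.single_mul_single, ← Pi.single_add, add_neg_cancel, Pi.single_zero]
      split_ifs <;> simp [AddMonoidAlgebra.singleZeroRingHom])

theorem toLaurent_w (α : Fin n → ℤ) (i : Fin n) (m : ℤ) : ∃ c : D,
    toLaurent G α (w G i m) = AddMonoidAlgebra.single (Pi.single i m) c ∧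
      (m = α i → c = 1) := by
  rcases m.eq_nat_or_neg with ⟨k, rfl | rfl⟩
  · refine ⟨(if 0 ≤ α i then 1 else G.a i) ^ k, ?_, fun h => ?_⟩
    · rw [w_natCast, map_pow, toLaurent, lift_X, AddMonoidAlgebra.single_pow, ← Pi.single_smul']
      simp
    · rw [if_pos (by omega), one_pow]
  · refine ⟨(if 0 ≤ α i then G.a i else 1) ^ k, ?_, fun h => ?_⟩
    · rw [w_neg_natCast, map_pow, toLaurent, lift_Y, AddMonoidAlgebra.single_pow,
        ← Pi.single_smul']
      simp
    -- Here `αᵢ = 0` falls under the nonnegative case, where `Yᵢ` carries `aᵢ`, but its exponent is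
    -- `0`.
    · rcases k with _ | k
      · rw [pow_zero]
      · rw [if_neg (by push_cast at h; omega), one_pow]

theorem toLaurent_v (α β : Fin n → ℤ) : ∃ c : D,
    toLaurent G α (v G β) = AddMonoidAlgebra.single β c ∧ (β = α → c = 1) := by
  choose c hc hc' using fun i => toLaurent_w G α i (β i)
  refine ⟨∏ i, c i, ?_, fun h => Finset.prod_eq_one fun i _ => hc' i (congrFun h i)⟩
  rw [v, map_prod, Finset.prod_congr rfl fun i _ => hc i, AddMonoidAlgebra.prod_single,
    Finset.univ_sum_single]

/-- The coefficient of `v_α`. -/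
noncomputable def coeff (α : Fin n → ℤ) : GWPA G →+ D where
  toFun x := (toLaurent G α x).coeff α
  map_zero' := by simp
  map_add' := by simp

/-- This is the linear independence of the `v_β`: `toLaurent G α` respects degrees and has
coefficient `1` on `v_α`. -/
theorem coeff_term (α β : Fin n → ℤ) (l : D) :
    coeff G α (ι G l * v G β) = if β = α then l else 0 := by
  obtain ⟨c, hc, hc'⟩ := toLaurent_v G α β
  change (toLaurent G α (ι G l * v G β)).coeff α = _
  rw [map_mul, hc, toLaurent, lift_D]
  change (AddMonoidAlgebra.single 0 l * AddMonoidAlgebra.single β c).coeff α = _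
  rw [AddMonoidAlgebra.single_mul_single, zero_add, AddMonoidAlgebra.coeff_single]
  split_ifs with h
  · rw [hc' h, mul_one, h, Finsupp.single_eq_same]
  · rw [Finsupp.single_eq_of_ne (Ne.symm h)]

theorem coeff_ι (α : Fin n → ℤ) (l : D) : coeff G α (ι G l) = if α = 0 then l else 0 := by
  rw [← mul_one (ι G l), ← v_zero, coeff_term]
  simp only [eq_comm]

theorem coeff_ι_mul (α : Fin n → ℤ) (d : D) (x : GWPA G) :
    coeff G α (ι G d * x) = d * coeff G α x := by
  refine term_induction G (p := fun x => coeff G α (ι G d * x) = d * coeff G α x) (by simp)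
    (fun x y hx hy => by rw [mul_add, map_add, map_add, hx, hy, mul_add]) (fun l β => ?_) x
  rw [← mul_assoc, ← map_mul, coeff_term, coeff_term, mul_ite, mul_zero]

theorem coeff_pad_D (α : Fin n → ℤ) (d : D) (x : GWPA G) : coeff G α (pad K (ι G d) x) =
    pad K d (coeff G α x) + coeff G α x * ∑ i, α i * G.der i d := by
  refine term_induction G (p := fun x => coeff G α (pad K (ι G d) x) =
    pad K d (coeff G α x) + coeff G α x * ∑ i, α i * G.der i d) (by simp)
    (fun x y hx hy => by simp only [map_add, hx, hy]; ring) (fun l β => ?_) x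
  rw [pad_D_term, coeff_term, coeff_term]
  split_ifs with h
  · rw [h]
  · simp

theorem coeff_pad_X (α : Fin n → ℤ) (i : Fin n) (x : GWPA G) :
    coeff G (α + Pi.single i 1) (pad K (X G i) x) =
      coeff G α x * upPad G i (α i) - G.der i (coeff G α x) * upMul G i (α i) := by
  induction x using term_induction with
  | h0 => simp
  | hadd x y hx hy => simp only [map_add, hx, hy]; ring
  | hterm l β =>
    rw [pad_X_term, coeff_term, coeff_term]
    simp only [add_left_inj]
    split_ifs with h
    · rw [h]
    · simp

theorem coeff_pad_Y (α : Fin n → ℤ) (i : Fin n) (x : GWPA G) :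
    coeff G (α - Pi.single i 1) (pad K (Y G i) x) =
      coeff G α x * downPad G i (α i) + G.der i (coeff G α x) * downMul G i (α i) := by
  induction x using term_induction with
  | h0 => simp
  | hadd x y hx hy => simp only [map_add, hx, hy]; ring
  | hterm l β =>
    rw [pad_Y_term, coeff_term, coeff_term]
    simp only [sub_left_inj]
    split_ifs with h
    · rw [h]
    · simp

variable {G} in
theorem eq_ι_coeff_zero {x : GWPA G} (h : ∀ α, α ≠ 0 → coeff G α x = 0) :
    x = ι G (coeff G 0 x) := by
  classical
  obtain ⟨f, rfl⟩ := exists_eq_sum G x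
  have hf (α : Fin n → ℤ) : coeff G α (f.sum fun α l => ι G l * v G α) = f α := by
    simp only [Finsupp.sum, map_sum, coeff_term]
    rw [Finset.sum_ite_eq']
    split_ifs with hα
    · rfl
    · exact (Finsupp.notMem_support_iff.1 hα).symm
  rw [hf 0]
  rw [Finsupp.sum, Finset.sum_eq_single 0, v_zero, mul_one]
  · intro α _ hα
    rw [← hf α, h α hα]
    simp [ι]
  · intro h0
    rw [Finsupp.notMem_support_iff.1 h0]
    simp [ι]

-- Skew-symmetry rewrites the condition on `pad λ` as the vanishing of the coefficient of `{d, λ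
-- v_α}`, the form in which it appears in `coeff_pad_D`.
variable {G} in
theorem mem_weight_iff {α : Fin n → ℤ} {l : D} : l ∈ G.weight α ↔ (∀ i, G.der i l = 0) ∧
    (∀ d, pad K d l + l * ∑ i, α i * G.der i d = 0) ∧
      ∀ i, l * (α i : D) * G.der i (G.a i) = 0 := by
  have h : pad K l = l • ∑ i, α i • G.der i ↔
      ∀ d, pad K d l + l * ∑ i, α i * G.der i d = 0 := by
    have hs (d : D) : (l • ∑ i, α i • G.der i) d = l * ∑ i, α i * G.der i d := by
      rw [Derivation.smul_apply, smul_eq_mul]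
      congr 1
      rw [← Derivation.coeFnAddMonoidHom_apply, map_sum, Finset.sum_apply]
      simp
    rw [Derivation.ext_iff]
    refine forall_congr' fun d => ?_
    rw [hs, pad_skew K l d, neg_eq_iff_add_eq_zero]
  rw [← h]
  rfl

variable {G} in
/-- The homogeneous components of a Poisson central element are Poisson central. -/
theorem coeff_mem_weight {z : GWPA G} (hz : z ∈ center K (GWPA G)) (α : Fin n → ℤ) :
    coeff G α z ∈ G.weight α := by
  have hX (i : Fin n) := coeff_pad_X G α i z
  have hY (i : Fin n) := coeff_pad_Y G α i z
  simp only [pad_center hz, map_zero] at hX hY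
  have hder (i : Fin n) : G.der i (coeff G α z) = 0 := by
    -- The generator whose power occurs in `v_α` commutes with `v_α`, so its bracket sees only `∂ᵢ`
    -- of the coefficient. Once that vanishes, the opposite generator yields the condition on `αᵢ
    -- ∂ᵢ(aᵢ)`.
    rcases le_total 0 (α i) with h | h
    · simpa [upPad, upMul, h] using hX i
    · simpa [downPad, downMul, h] using (hY i).symm
  refine mem_weight_iff.2 ⟨hder, fun d => ?_, fun i => ?_⟩
  · rw [← coeff_pad_D, pad_center hz, map_zero]
  · have hXi := hX i
    have hYi := hY i
    rw [hder, zero_mul, sub_zero] at hXi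
    rw [hder, zero_mul, add_zero] at hYi
    rcases lt_trichotomy (α i) 0 with h | h | h
    · rw [upPad, if_neg (by omega)] at hXi
      rw [mul_assoc, ← hXi]
    · simp [h]
    · rw [downPad, if_neg (by omega)] at hYi
      rw [mul_assoc, ← hYi]

variable {G} in
theorem term_mem_center {α : Fin n → ℤ} {l : D} (hl : l ∈ G.weight α) :
    ι G l * v G α ∈ center K (GWPA G) := by
  obtain ⟨h1, h2, h3⟩ := mem_weight_iff.1 hl
  intro x
  rw [pad_skew, neg_eq_zero]
  refine induction (p := fun x => pad K x (ι G l * v G α) = 0) (fun d => ?_) (fun i => ?_)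
    (fun i => ?_) (fun x y hx hy => ?_) (fun x y hx hy => ?_) x
  · rw [pad_D_term, h2]; simp [ι]
  · rw [pad_X_term, h1, zero_mul, sub_zero, upPad, mul_ite, ← mul_assoc, h3]; simp [ι]
  · rw [pad_Y_term, h1, zero_mul, add_zero, downPad, mul_ite, ← mul_assoc, h3]; simp [ι]
  · rw [pad_add_left, Derivation.add_apply, hx, hy, add_zero]
  · rw [pad_mul_left, Derivation.add_apply, Derivation.smul_apply, Derivation.smul_apply, hx, hy,
      smul_zero, smul_zero, add_zero]

variable {G} in
theorem mem_weight_zero_iff {l : D} :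
    l ∈ G.weight 0 ↔ l ∈ (center K D ⊓ G.constants : Subalgebra K D) := by
  rw [mem_weight_iff, Algebra.mem_inf]
  constructor
  · rintro ⟨h1, h2, -⟩
    exact ⟨fun d => by rw [pad_skew]; simpa using h2 d, h1⟩
  · rintro ⟨h1, h2⟩
    exact ⟨h2, fun d => by rw [pad_center h1]; simp, fun i => by simp⟩

variable {G} in
theorem zero_mem_weight (α : Fin n → ℤ) : 0 ∈ G.weight α := by
  refine mem_weight_iff.2 ⟨by simp, by simp, by simp⟩

variable {G} in
/-- If the Poisson centre of `A` is a field then it is concentrated in degree zero. -/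
theorem weight_eq_of_isField_center (h : IsField (center K (GWPA G))) {α : Fin n → ℤ}
    (hα : α ≠ 0) : G.weight α = {0} := by
  refine Set.eq_singleton_iff_unique_mem.2 ⟨zero_mem_weight α, fun l hl => ?_⟩
  by_contra hl0
  have hD : Nontrivial D := ⟨l, 0, hl0⟩
  obtain ⟨i, hi⟩ := Function.ne_iff.1 hα
  obtain ⟨m, hm⟩ := Ideal.exists_maximal D
  let _ : Field (D ⧸ m) := Ideal.Quotient.field m
  let k := AlgebraicClosure (D ⧸ m)
  let f : D →+* k := (algebraMap (D ⧸ m) k).comp (Ideal.Quotient.mk m)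
  -- Points of `A` over the algebraically closed field `k` at which `v_α` takes the value `t ^
  -- |αᵢ|`: the variables occurring in `v_α` get the nonzero values `s j`, and their partners are
  -- then determined by `XⱼYⱼ = aⱼ`.
  have hψ (t : k) (ht : t ≠ 0) :
      ∃ ψ : GWPA G →+* k, ψ (ι G l * v G α) = f l * t ^ (α i).natAbs := by
    let s : Fin n → k := fun j => if j = i then t else 1
    have hs (j : Fin n) : s j ≠ 0 := by simp only [s]; split_ifs <;> simp [ht]
    let ψ : GWPA G →+* k := lift f (fun j => if 0 ≤ α j then s j else f (G.a j) * (s j)⁻¹)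
      (fun j => if 0 ≤ α j then f (G.a j) * (s j)⁻¹ else s j) (fun j => by
        have := hs j
        split_ifs
        · rw [mul_comm, mul_assoc, inv_mul_cancel₀ this, mul_one]
        · rw [mul_assoc, inv_mul_cancel₀ this, mul_one])
    have hw (j : Fin n) : ψ (w G j (α j)) = s j ^ (α j).natAbs := by
      rcases le_or_gt 0 (α j) with h | h
      · obtain ⟨q, hq⟩ := Int.eq_ofNat_of_zero_le h
        rw [hq, w_natCast, map_pow, lift_X, if_pos h, Int.natAbs_natCast]
      · obtain ⟨q, hq⟩ := Int.eq_ofNat_of_zero_le (neg_nonneg.2 h.le)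
        rw [← neg_neg (α j), hq, w_neg_natCast, map_pow, lift_Y, if_neg (not_le.2 h),
          Int.natAbs_neg, Int.natAbs_natCast]
    refine ⟨ψ, ?_⟩
    rw [map_mul, lift_D, v, map_prod, Finset.prod_eq_single i]
    · rw [hw]
      simp [s]
    · intro j _ hj
      rw [hw]
      simp [s, hj]
    · simp
  have hz := term_mem_center hl
  have hinv {z : GWPA G} (hz : z ∈ center K (GWPA G)) (hz0 : z ≠ 0) : IsUnit z := by
    obtain ⟨u, hu⟩ := h.mul_inv_cancel (a := ⟨z, hz⟩) fun h => hz0 (congrArg Subtype.val h)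
    exact IsUnit.of_mul_eq_one _ (congrArg Subtype.val hu)
  have hz0 : ι G l * v G α ≠ 0 := fun h => hl0 <| by
    have := congrArg (coeff G α) h
    rwa [coeff_term, if_pos rfl, map_zero] at this
  have h1z0 : 1 - ι G l * v G α ≠ 0 := fun h => one_ne_zero (α := D) <| by
    have := congrArg (coeff G 0) h
    rw [map_sub, coeff_term, if_neg hα, sub_zero, map_zero, ← map_one (algebraMap D (GWPA G)),
      coeff_ι, if_pos rfl] at this
    exact this
  -- The unit `λ v_α` has nonzero image at the point `t = 1`. Solving `t ^ |αᵢ| = f(λ)⁻¹` then gives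
  -- a point at which the unit `1 - λ v_α` vanishes.
  have hfl : f l ≠ 0 := by
    obtain ⟨ψ, hψ⟩ := hψ 1 one_ne_zero
    have := ((hinv hz hz0).map ψ).ne_zero
    rwa [hψ, one_pow, mul_one] at this
  obtain ⟨t, ht⟩ := IsAlgClosed.exists_pow_nat_eq (f l)⁻¹
    (Int.natAbs_pos.2 (show α i ≠ 0 from hi))
  have ht0 : t ≠ 0 := by
    rintro rfl
    rw [zero_pow (Int.natAbs_ne_zero.2 hi)] at ht
    exact inv_ne_zero hfl ht.symm
  obtain ⟨ψ, hψ⟩ := hψ t ht0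
  refine ((hinv (sub_mem (one_mem _) hz) h1z0).map ψ).ne_zero ?_
  rw [map_sub, map_one, hψ, ht, mul_inv_cancel₀ hfl, sub_self]

end GWPA

/-! ### When the Poisson centre of `A` is a field. -/

namespace GWPA

open PoissonAlgebra

variable {K D : Type*} [Field K] [CommRing D] [Algebra K D] [PoissonAlgebra K D] {n : ℕ}
variable {G : GWPAData K D n}

/-- If `m = 0` in `K`, then the integer vector `m e₁` acts on `D` as zero, so `1` satisfies all the
conditions of that degree; hence `m e₁ = 0`. -/
theorem charZero_of_weight_eq [Nontrivial D] (hn : 0 < n)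
    (h : ∀ α : Fin n → ℤ, α ≠ 0 → G.weight α = {0}) : CharZero K := by
  refine charZero_of_inj_zero fun m hm => ?_
  by_contra hm0
  have hmD : ((m : ℤ) : D) = 0 := by
    rw [Int.cast_natCast, ← map_natCast (algebraMap K D), hm, map_zero]
  have hc (i : Fin n) : ((Pi.single ⟨0, hn⟩ (m : ℤ) : Fin n → ℤ) i : D) = 0 := by
    rcases eq_or_ne i ⟨0, hn⟩ with rfl | hi
    · rw [Pi.single_eq_same, hmD]
    · rw [Pi.single_eq_of_ne hi, Int.cast_zero]
  have h1 : (1 : D) ∈ G.weight (Pi.single ⟨0, hn⟩ (m : ℤ)) :=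
    mem_weight_iff.2 ⟨by simp, by simp [hc], by simp [hc]⟩
  rw [h _ (fun h0 => hm0 (by simpa using h0))] at h1
  exact one_ne_zero h1

/-- The criterion for the Poisson centre of `A` to be a field. -/
theorem isField_center_iff (hn : 0 < n) : IsField (center K (GWPA G)) ↔
    CharZero K ∧ IsField (center K D ⊓ G.constants : Subalgebra K D) ∧
      ∀ α : Fin n → ℤ, α ≠ 0 → G.weight α = {0} := by
  constructor
  · intro h
    have hw : ∀ α : Fin n → ℤ, α ≠ 0 → G.weight α = {0} :=
      fun α hα => weight_eq_of_isField_center h hα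
    have hD : Nontrivial D := by
      by_contra hD
      rw [not_nontrivial_iff_subsingleton] at hD
      obtain ⟨x, y, hxy⟩ := h.exists_pair_ne
      refine hxy (Subtype.ext ?_)
      rw [← one_mul (x : GWPA G), ← one_mul (y : GWPA G), ← map_one (algebraMap D (GWPA G)),
        Subsingleton.elim (1 : D) 0, map_zero, zero_mul, zero_mul]
    refine ⟨charZero_of_weight_eq hn hw, ⟨⟨0, 1, zero_ne_one⟩, mul_comm, fun {l} hl => ?_⟩, hw⟩
    have hl0 : (l : D) ≠ 0 := fun h => hl (Subtype.ext h)
    have hlA : ι G (l : D) ∈ center K (GWPA G) := by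
      have := term_mem_center (mem_weight_zero_iff.2 l.2)
      rwa [v_zero, mul_one] at this
    obtain ⟨u, hu⟩ := h.mul_inv_cancel (a := ⟨_, hlA⟩) fun h => hl0 <| ι_injective (G := G) <| by
      exact (congrArg Subtype.val h).trans (map_zero (algebraMap D (GWPA G))).symm
    -- The degree zero component of the inverse is still an inverse, because `coeff` is `D`-linear.
    refine ⟨⟨coeff G 0 u, mem_weight_zero_iff.1 (coeff_mem_weight u.2 0)⟩, Subtype.ext ?_⟩
    have := congrArg (fun x => coeff G 0 (Subtype.val x)) hu
    change coeff G 0 (ι G (l : D) * u) = coeff G 0 1 at this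
    rw [coeff_ι_mul, ← map_one (algebraMap D (GWPA G)), coeff_ι, if_pos rfl] at this
    exact this
  · rintro ⟨-, h, hw⟩
    have hD : Nontrivial D := by
      obtain ⟨x, y, hxy⟩ := h.exists_pair_ne
      exact ⟨x, y, fun h => hxy (Subtype.ext h)⟩
    refine ⟨⟨0, 1, fun h => one_ne_zero (α := D) (ι_injective (G := G) ?_)⟩, mul_comm,
      fun {z} hz => ?_⟩
    · rw [ι, map_one, ι, map_zero]
      exact (congrArg Subtype.val h).symm
    have hzι : (z : GWPA G) = ι G (coeff G 0 z) := eq_ι_coeff_zero fun α hα => by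
      have := coeff_mem_weight z.2 α
      rwa [hw α hα] at this
    have hz0 : coeff G 0 (z : GWPA G) ≠ 0 := fun h0 => hz <| Subtype.ext <| by
      rw [hzι, h0]; exact map_zero _
    obtain ⟨u, hu⟩ := h.mul_inv_cancel
      (a := ⟨_, mem_weight_zero_iff.1 (coeff_mem_weight z.2 0)⟩)
      fun h => hz0 (congrArg Subtype.val h)
    have huA : ι G (u : D) ∈ center K (GWPA G) := by
      have := term_mem_center (mem_weight_zero_iff.2 u.2)
      rwa [v_zero, mul_one] at this
    refine ⟨⟨_, huA⟩, Subtype.ext ?_⟩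
    change (z : GWPA G) * ι G (u : D) = 1
    rw [hzι, ← map_mul, show coeff G 0 (z : GWPA G) * (u : D) = 1 from congrArg Subtype.val hu,
      map_one]

end GWPA

/-! ### Poisson ideals of `A`: translated supports, minimality, and sufficiency. -/

namespace GWPA

open PoissonAlgebra

section Shift

variable {K D : Type*} [CommRing K] [CommRing D] [Algebra K D] [PoissonAlgebra K D] {n : ℕ}
variable (G : GWPAData K D n)

/-- Each of the `(-k).toNat` factors `Yᵢ` cancels against an `Xᵢ` and leaves a factor `aᵢ`. -/
theorem w_mul_w (i : Fin n) {m k : ℤ} (hm : 0 ≤ m) (hk : 0 ≤ k + m) :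
    w G i m * w G i k = ι G (G.a i ^ (-k).toNat) * w G i (k + m) := by
  obtain ⟨p, rfl⟩ := Int.eq_ofNat_of_zero_le hm
  rcases k.eq_nat_or_neg with ⟨q, rfl | rfl⟩
  · rw [← Nat.cast_add, w_natCast, w_natCast, w_natCast]
    simp [ι, pow_add, mul_comm]
  · obtain ⟨r, rfl⟩ : ∃ r, p = q + r := ⟨p - q, by omega⟩
    rw [show -(q : ℤ) + ((q + r : ℕ) : ℤ) = (r : ℤ) by push_cast; ring, w_natCast, w_natCast,
      w_neg_natCast, neg_neg, Int.toNat_natCast, ι, map_pow, ← ι, ← X_mul_Y]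
    ring

theorem v_mul_v {γ α : Fin n → ℤ} (hγ : 0 ≤ γ) (hα : 0 ≤ α + γ) :
    v G γ * v G α = ι G (∏ i, G.a i ^ (-α i).toNat) * v G (α + γ) := by
  rw [v, v, v, ι, map_prod, ← Finset.prod_mul_distrib, ← Finset.prod_mul_distrib]
  exact Finset.prod_congr rfl fun i _ => w_mul_w G i (hγ i) (hα i)

/-- The element `∑_{β ∈ S} c_β v_(β + γ)`. -/
noncomputable def shiftedSum (S : Finset (Fin n → ℤ)) (γ : Fin n → ℤ) (c : (Fin n → ℤ) → D) :
    GWPA G := ∑ β ∈ S, ι G (c β) * v G (β + γ)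

variable {G} {S : Finset (Fin n → ℤ)} {γ : Fin n → ℤ} {c : (Fin n → ℤ) → D} {I : Ideal (GWPA G)}

/-- Multiplication by `v_(γ' - γ)` produces no factors `aᵢ` in nonnegative degrees. Two sums with
different shifts can thus be brought to a common one and added. -/
theorem shiftedSum_mono {γ' : Fin n → ℤ} (hS : ∀ β ∈ S, 0 ≤ β + γ) (hγ : γ ≤ γ')
    (h : shiftedSum G S γ c ∈ I) : shiftedSum G S γ' c ∈ I := by
  have h1 : v G (γ' - γ) * shiftedSum G S γ c = shiftedSum G S γ' c := by
    rw [shiftedSum, Finset.mul_sum]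
    refine Finset.sum_congr rfl fun β hβ => ?_
    rw [mul_left_comm, v_mul_v G (sub_nonneg.2 hγ) (add_nonneg (hS β hβ) (sub_nonneg.2 hγ)),
      Finset.prod_eq_one, show ι G 1 = 1 from map_one _, one_mul]
    · congr 2
      abel
    · intro i _
      rw [Int.toNat_eq_zero.2 (neg_nonpos.2 (hS β hβ i)), pow_zero]
  rw [← h1]
  exact I.mul_mem_left _ h

/-- Subtracting the multiple that `{d, ·}` produces on `v_(β₀ + γ)` makes the outcome depend only on
`β - β₀`: at `β₀` only `{d, c_β₀}` is left, and elsewhere the defining expression of `D_(β - β₀)`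
appears. -/
theorem shiftedSum_pad_D (hI : IsPoissonIdeal K I) (β₀ : Fin n → ℤ)
    (h : shiftedSum G S γ c ∈ I) (d : D) : shiftedSum G S γ
      (fun β => pad K d (c β) + c β * ∑ i, ((β - β₀) i : ℤ) * G.der i d) ∈ I := by
  have h1 : pad K (ι G d) (shiftedSum G S γ c) -
      ι G (∑ i, ((β₀ + γ) i : ℤ) * G.der i d) * shiftedSum G S γ c =
      shiftedSum G S γ
        (fun β => pad K d (c β) + c β * ∑ i, ((β - β₀) i : ℤ) * G.der i d) := by
    simp only [shiftedSum, map_sum, Finset.mul_sum]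
    rw [← Finset.sum_sub_distrib]
    refine Finset.sum_congr rfl fun β _ => ?_
    rw [pad_D_term, ← mul_assoc, ← sub_mul, ← map_sum, ← map_mul, ← map_sub]
    congr 2
    have h2 : ∑ i, ((β - β₀) i : ℤ) * G.der i d =
        ∑ i, ((β + γ) i : ℤ) * G.der i d - ∑ i, ((β₀ + γ) i : ℤ) * G.der i d := by
      rw [← Finset.sum_sub_distrib]
      refine Finset.sum_congr rfl fun i _ => ?_
      simp only [Pi.sub_apply, Pi.add_apply]
      push_cast
      ring
    rw [← Finset.mul_sum, h2]
    ring
  rw [← h1]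
  exact I.sub_mem (hI _ _ h) (I.mul_mem_left _ h)

theorem shiftedSum_der (hI : IsPoissonIdeal K I) (hS : ∀ β ∈ S, 0 ≤ β + γ)
    (h : shiftedSum G S γ c ∈ I) (i : Fin n) :
    shiftedSum G S (γ + Pi.single i 1) (fun β => G.der i (c β)) ∈ I := by
  have h1 : -pad K (X G i) (shiftedSum G S γ c) =
      shiftedSum G S (γ + Pi.single i 1) (fun β => G.der i (c β)) := by
    rw [shiftedSum, map_sum, shiftedSum, ← Finset.sum_neg_distrib]
    refine Finset.sum_congr rfl fun β hβ => ?_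
    have h0 : 0 ≤ (β + γ) i := hS β hβ i
    rw [pad_X_term, upPad, upMul, if_pos h0, if_pos h0, mul_zero, mul_one,
      zero_sub, ← neg_mul, ← map_neg, neg_neg, add_assoc]
  rw [← h1]
  exact I.neg_mem (hI _ _ h)

/-- On constant coefficients `Xᵢ{Yᵢ, ·}` preserves degree and multiplies degree `β + γ` by `(β + γ)ᵢ
∂ᵢ(aᵢ)`. Subtracting the factor for `β₀` leaves the last condition of `D_(β - β₀)`. -/
theorem shiftedSum_pad_Y (hI : IsPoissonIdeal K I) (hS : ∀ β ∈ S, 0 ≤ β + γ) (β₀ : Fin n → ℤ)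
    (h : shiftedSum G S γ c ∈ I) (i : Fin n) (hc : ∀ β ∈ S, G.der i (c β) = 0) :
    shiftedSum G S γ (fun β => c β * ((β - β₀) i : ℤ) * G.der i (G.a i)) ∈ I := by
  have h1 : X G i * pad K (Y G i) (shiftedSum G S γ c) -
      ι G (((β₀ + γ) i : ℤ) * G.der i (G.a i)) * shiftedSum G S γ c =
      shiftedSum G S γ (fun β => c β * ((β - β₀) i : ℤ) * G.der i (G.a i)) := by
    simp only [shiftedSum, map_sum, Finset.mul_sum]
    rw [← Finset.sum_sub_distrib]
    refine Finset.sum_congr rfl fun β hβ => ?_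
    have h2 : X G i * pad K (Y G i) (ι G (c β) * v G (β + γ)) =
        ι G (c β * (((β + γ) i : ℤ) * G.der i (G.a i))) * v G (β + γ) := by
      rw [pad_Y_term, hc β hβ, zero_mul, add_zero, downPad]
      -- If `(β + γ)ᵢ = 0`, then `Yᵢ` commutes with the monomial, and the claimed multiplier is `0`
      -- as well.
      split_ifs with h0
      · rw [le_antisymm h0 (hS β hβ i)]
        simp [ι]
      · rw [mul_left_comm, X_mul_v, upMul, if_pos, sub_add_cancel, show ι G 1 = 1 from map_one _,
          one_mul]
        rw [Pi.sub_apply, Pi.single_eq_same]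
        omega
    rw [h2, ← mul_assoc (ι G _) (ι G _), ← sub_mul, ← map_mul, ← map_sub]
    congr 2
    simp only [Pi.sub_apply, Pi.add_apply]
    push_cast
    ring
  rw [← h1]
  exact I.sub_mem (I.mul_mem_left _ (hI _ _ h)) (I.mul_mem_left _ h)

variable (S I) in
/-- The coefficients `c_β₀` of the elements `∑_{β ∈ S} c_β v_(β + γ)` of `I`, where `γ` is such
that `β + γ ≥ 0` for all `β ∈ S`. -/
def coeffIdeal (β₀ : Fin n → ℤ) (hS : ∃ γ, ∀ β ∈ S, 0 ≤ β + γ) : Ideal D where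
  carrier := {l | ∃ γ c, (∀ β ∈ S, 0 ≤ β + γ) ∧ c β₀ = l ∧ shiftedSum G S γ c ∈ I}
  zero_mem' := by
    obtain ⟨γ, hγ⟩ := hS
    exact ⟨γ, 0, hγ, rfl, by simp [shiftedSum, ι]⟩
  add_mem' := by
    rintro _ _ ⟨γ, c, hγ, rfl, h⟩ ⟨γ', c', hγ', rfl, h'⟩
    refine ⟨γ ⊔ γ', c + c', fun β hβ => (hγ β hβ).trans (add_le_add_right le_sup_left _), rfl, ?_⟩
    have h1 := I.add_mem (shiftedSum_mono hγ (le_sup_left : γ ≤ γ ⊔ γ') h)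
      (shiftedSum_mono hγ' (le_sup_right : γ' ≤ γ ⊔ γ') h')
    rw [shiftedSum, shiftedSum, ← Finset.sum_add_distrib] at h1
    convert h1 using 1
    refine Finset.sum_congr rfl fun β _ => ?_
    rw [Pi.add_apply, ι, map_add, add_mul]
  smul_mem' := by
    rintro d _ ⟨γ, c, hγ, rfl, h⟩
    refine ⟨γ, fun β => d * c β, hγ, rfl, ?_⟩
    have h1 := I.mul_mem_left (ι G d) h
    rw [shiftedSum, Finset.mul_sum] at h1
    convert h1 using 1
    refine Finset.sum_congr rfl fun β _ => ?_
    rw [ι, map_mul, mul_assoc]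

theorem isPoissonIdeal_coeffIdeal (hI : IsPoissonIdeal K I) (β₀ : Fin n → ℤ)
    (hS : ∃ γ, ∀ β ∈ S, 0 ≤ β + γ) : IsPoissonIdeal K (coeffIdeal S I β₀ hS) := by
  rintro d _ ⟨γ, c, hγ, rfl, h⟩
  exact ⟨γ, _, hγ, by simp, shiftedSum_pad_D hI β₀ h d⟩

theorem isInvariant_coeffIdeal (hI : IsPoissonIdeal K I) (β₀ : Fin n → ℤ)
    (hS : ∃ γ, ∀ β ∈ S, 0 ≤ β + γ) : G.IsInvariant (coeffIdeal S I β₀ hS) := by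
  rintro i _ ⟨γ, c, hγ, rfl, h⟩
  refine ⟨_, _, fun β hβ => ?_, rfl, shiftedSum_der hI hγ h i⟩
  rw [← add_assoc]
  exact add_nonneg (hγ β hβ) (Pi.single_nonneg.2 zero_le_one)

end Shift

variable {K D : Type*} [Field K] [CommRing D] [Algebra K D] [PoissonAlgebra K D] {n : ℕ}
variable {G : GWPAData K D n} {I : Ideal (GWPA G)}

/-- If `γᵢ > 0`, then `Yᵢ v_γ` and `{Yᵢ, v_γ}` are `v_(γ - eᵢ)` times `aᵢ` and `γᵢ ∂ᵢ(aᵢ)`. As `γᵢ`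
is invertible, `hb` puts `v_(γ - eᵢ)` into `I`, and induction on the total degree reaches `v_0 = 1`.
-/
theorem eq_top_of_v_mem [CharZero K] (hI : IsPoissonIdeal K I)
    (hb : ∀ i, Ideal.span {G.a i} ⊔ Ideal.span {G.der i (G.a i)} = ⊤)
    {γ : Fin n → ℤ} (hγ : 0 ≤ γ) (h : v G γ ∈ I) : I = ⊤ := by
  induction hk : ∑ i, (γ i).toNat generalizing γ with
  | zero =>
    have h0 : γ = 0 := by
      ext i
      have := (Finset.sum_eq_zero_iff.1 hk) i (Finset.mem_univ i)
      exact le_antisymm (Int.toNat_eq_zero.1 this) (hγ i)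
    rw [h0, v_zero] at h
    exact (Ideal.eq_top_iff_one I).2 h
  | succ k ih =>
    obtain ⟨i, hi⟩ : ∃ i, 0 < γ i := by
      by_contra! hle
      rw [Finset.sum_eq_zero fun i _ => Int.toNat_eq_zero.2 (hle i)] at hk
      omega
    have h1 := I.mul_mem_left (Y G i) h
    rw [Y_mul_v, downMul, if_neg (not_le.2 hi)] at h1
    have h2 := hI (Y G i) _ h
    rw [pad_Y_v, downPad, if_neg (not_le.2 hi), ι, map_mul, mul_assoc] at h2
    have hu : IsUnit (algebraMap D (GWPA G) (γ i : D)) := by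
      rw [← map_intCast (algebraMap K D)]
      exact ((IsUnit.mk0 _ (Int.cast_ne_zero.2 hi.ne')).map (algebraMap K D)).map _
    have h3 := (I.unit_mul_mem_iff_mem hu).1 h2
    have h4 : v G (γ - Pi.single i 1) ∈ I := by
      obtain ⟨x, hx, y, hy, hxy⟩ := Submodule.mem_sup.1 ((Ideal.eq_top_iff_one _).1 (hb i))
      obtain ⟨p, rfl⟩ := Ideal.mem_span_singleton'.1 hx
      obtain ⟨q, rfl⟩ := Ideal.mem_span_singleton'.1 hy
      rw [← one_mul (v G _), ← map_one (algebraMap D (GWPA G)), ← hxy, map_add, map_mul, map_mul,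
        add_mul, mul_assoc, mul_assoc]
      exact I.add_mem (I.mul_mem_left _ h1) (I.mul_mem_left _ h3)
    refine ih (γ := γ - Pi.single i 1) (fun j => ?_) h4 ?_
    · rcases eq_or_ne j i with rfl | hj
      · simp; omega
      · simpa [hj] using hγ j
    · rw [← Finset.add_sum_erase _ _ (Finset.mem_univ i)] at hk ⊢
      have h5 : ∑ j ∈ Finset.univ.erase i, ((γ - Pi.single i 1 : Fin n → ℤ) j).toNat =
          ∑ j ∈ Finset.univ.erase i, (γ j).toNat :=
        Finset.sum_congr rfl fun j hj => by simp [Finset.ne_of_mem_erase hj]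
      rw [h5]
      simp only [Pi.sub_apply, Pi.single_eq_same]
      omega

/-- Multiplying by `v_γ` with `γ` large changes the coefficients only by products of powers of the
`aᵢ`, which are not zero divisors here. -/
theorem exists_shiftedSum_mem [IsDomain D] (ha : ∀ i, G.a i ≠ 0) (hI0 : I ≠ ⊥) :
    ∃ S γ c, (∀ β ∈ S, 0 ≤ β + γ) ∧ (∃ β ∈ S, c β ≠ 0) ∧ shiftedSum G S γ c ∈ I := by
  obtain ⟨x, hx, hx0⟩ := Submodule.exists_mem_ne_zero_of_ne_bot hI0
  obtain ⟨f, rfl⟩ := exists_eq_sum G x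
  have hf : f ≠ 0 := by rintro rfl; simp at hx0
  obtain ⟨β, hβ⟩ := Finsupp.support_nonempty_iff.2 hf
  let γ : Fin n → ℤ := fun i => ∑ α ∈ f.support, |α i|
  have hγ : 0 ≤ γ := fun i => Finset.sum_nonneg fun _ _ => abs_nonneg _
  have hfγ : ∀ β ∈ f.support, 0 ≤ β + γ := fun β hβ i => by
    have h1 : |β i| ≤ γ i := Finset.single_le_sum (f := fun α : Fin n → ℤ => |α i|)
      (fun _ _ => abs_nonneg _) hβ
    have h2 := neg_abs_le (β i)
    simp only [Pi.add_apply, Pi.zero_apply]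
    omega
  refine ⟨f.support, γ, fun β => f β * ∏ i, G.a i ^ (-β i).toNat, hfγ, ⟨β, hβ, ?_⟩, ?_⟩
  · exact mul_ne_zero (Finsupp.mem_support_iff.1 hβ)
      (Finset.prod_ne_zero_iff.2 fun i _ => pow_ne_zero _ (ha i))
  · have h1 := I.mul_mem_left (v G γ) hx
    rw [Finsupp.sum, Finset.mul_sum] at h1
    convert h1 using 1
    refine Finset.sum_congr rfl fun β hβ => ?_
    rw [mul_left_comm, v_mul_v G hγ (hfγ β hβ), ι, map_mul, mul_assoc]

/-- A minimal support argument. The finite set `S` is kept fixed and only the shift `γ` varies, so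
that elements with supports in different translates of `S` can be compared. -/
theorem eq_top_of_ne_bot [CharZero K] [IsDomain D] (hI : IsPoissonIdeal K I)
    (hD : ∀ I : Ideal D, IsPoissonIdeal K I → G.IsInvariant I → I = ⊥ ∨ I = ⊤)
    (hb : ∀ i, Ideal.span {G.a i} ⊔ Ideal.span {G.der i (G.a i)} = ⊤)
    (hw : ∀ α : Fin n → ℤ, α ≠ 0 → G.weight α = {0}) (hI0 : I ≠ ⊥) : I = ⊤ := by
  have ha (i : Fin n) : G.a i ≠ 0 := fun h => by
    have := hb i
    rw [h, map_zero, Ideal.span_singleton_zero, sup_bot_eq] at this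
    exact bot_ne_top this
  obtain ⟨S, ⟨γ₀, c₀, hγ₀, ⟨β₀, hβ₀, hc₀⟩, h₀⟩, hmin⟩ :=
    (measure Finset.card).wf.has_min
      {S : Finset (Fin n → ℤ) | ∃ (γ : Fin n → ℤ) (c : (Fin n → ℤ) → D), (∀ β ∈ S, 0 ≤ β + γ) ∧
        (∃ β ∈ S, c β ≠ 0) ∧ shiftedSum G S γ c ∈ I} (exists_shiftedSum_mem ha hI0)
  -- Otherwise `S.erase β₀` would be a smaller support.
  have hzero {γ : Fin n → ℤ} {c : (Fin n → ℤ) → D} (hγ : ∀ β ∈ S, 0 ≤ β + γ) (hc : c β₀ = 0)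
      (h : shiftedSum G S γ c ∈ I) : ∀ β ∈ S, c β = 0 := by
    intro β hβ
    by_contra hβc
    refine hmin (S.erase β₀) ⟨γ, c, fun β hβ => hγ β (Finset.mem_of_mem_erase hβ),
      ⟨β, Finset.mem_erase.2 ⟨fun h => hβc (h ▸ hc), hβ⟩, hβc⟩, ?_⟩
      (Finset.card_erase_lt_of_mem hβ₀)
    rw [shiftedSum, Finset.sum_erase]
    · exact h
    · simp [hc, ι]
  have hS : ∃ γ, ∀ β ∈ S, 0 ≤ β + γ := ⟨γ₀, hγ₀⟩
  have htop := (hD _ (isPoissonIdeal_coeffIdeal hI β₀ hS)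
    (isInvariant_coeffIdeal hI β₀ hS)).resolve_left fun hbot => hc₀ <| by
      have h1 : c₀ β₀ ∈ coeffIdeal S I β₀ hS := ⟨γ₀, c₀, hγ₀, rfl, h₀⟩
      rwa [hbot, Submodule.mem_bot] at h1
  -- An element of `I` with `c β₀ = 1`. The three bracket operations below annihilate this
  -- coefficient, hence all coefficients by `hzero`.
  obtain ⟨γ, c, hγ, hc, h⟩ : (1 : D) ∈ coeffIdeal S I β₀ hS := htop ▸ Submodule.mem_top
  have hder (i : Fin n) : ∀ β ∈ S, G.der i (c β) = 0 :=
    hzero (fun β hβ => by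
      rw [← add_assoc]
      exact add_nonneg (hγ β hβ) (Pi.single_nonneg.2 zero_le_one))
      (by rw [hc, Derivation.map_one_eq_zero]) (shiftedSum_der hI hγ h i)
  have hcβ : ∀ β ∈ S, β ≠ β₀ → c β = 0 := fun β hβ hne => by
    have hmem : c β ∈ G.weight (β - β₀) := mem_weight_iff.2 ⟨fun i => hder i β hβ,
      fun d => hzero hγ (by simp [hc]) (shiftedSum_pad_D hI β₀ h d) β hβ,
      fun i => hzero hγ (by simp) (shiftedSum_pad_Y hI hγ β₀ h i (hder i)) β hβ⟩
    rwa [hw _ (sub_ne_zero.2 hne)] at hmem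
  rw [shiftedSum, Finset.sum_eq_single_of_mem β₀ hβ₀
    (fun β hβ hne => by rw [hcβ β hβ hne]; simp [ι]), hc, ι, map_one, one_mul] at h
  exact eq_top_of_v_mem hI hb (hγ β₀ hβ₀) h

/-- A sufficient condition for the Poisson simplicity of `A`. -/
theorem isPoissonSimple_of_isField_center
    (hD : ∀ I : Ideal D, IsPoissonIdeal K I → G.IsInvariant I → I = ⊥ ∨ I = ⊤)
    (hb : ∀ i, Ideal.span {G.a i} ⊔ Ideal.span {G.der i (G.a i)} = ⊤)
    (hc : IsField (center K (GWPA G))) : IsPoissonSimple K (GWPA G) := by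
  obtain ⟨x, y, hxy⟩ := hc.exists_pair_ne
  refine ⟨⟨x, y, fun h => hxy (Subtype.ext h)⟩, fun I hI => ?_⟩
  -- For `n = 0` the characteristic may be positive and `D` need not be a domain, but then `A` is
  -- just `D`.
  rcases Nat.eq_zero_or_pos n with rfl | hn
  · have hsurj : Function.Surjective (algebraMap D (GWPA G)) := fun x =>
      ⟨_, (eq_ι_coeff_zero fun α hα => (hα (Subsingleton.elim _ _)).elim).symm⟩
    rw [← Ideal.map_comap_of_surjective _ hsurj I]
    rcases hD (I.comap (algebraMap D (GWPA G)))
      (fun d x hx => by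
        rw [Ideal.mem_comap, ← ι, ← pad_D_D]
        exact hI _ _ hx)
      (fun i => i.elim0) with h | h
    · left; rw [h, Ideal.map_bot]
    · right; rw [h, Ideal.map_top]
  · obtain ⟨hK, hF, hw⟩ := (isField_center_iff hn).1 hc
    obtain ⟨x, y, hxy⟩ := hF.exists_pair_ne
    have hD0 : Nontrivial D := ⟨x, y, fun h => hxy (Subtype.ext h)⟩
    -- Ideals stable under all `pad d` and all `∂ᵢ` are exactly the `∂`-invariant Poisson ideals.
    have hdom : IsDomain D := isDomain_of_differentially_simple
      (Set.range (fun d : D => pad K d) ∪ Set.range G.der) fun J hJ =>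
        hD J (fun d => hJ _ (Or.inl ⟨d, rfl⟩)) (fun i => hJ _ (Or.inr ⟨i, rfl⟩))
    exact or_iff_not_imp_left.2 (eq_top_of_ne_bot hI hD hb hw)

end GWPA

theorem corollary4p3 {K D : Type*} [Field K] [CommRing D] [Algebra K D] [PoissonAlgebra K D]
    {n : ℕ} (G : GWPAData K D n) :
    (IsSimpleRing (PoissonAlgebra.diffOp K (GWPA G)) ↔
      (∀ I : Ideal D, PoissonAlgebra.IsPoissonIdeal K I → G.IsInvariant I → I = ⊥ ∨ I = ⊤) ∧
      (∀ i, Ideal.span {G.a i} ⊔ Ideal.span {G.der i (G.a i)} = ⊤) ∧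
      IsField (PoissonAlgebra.center K (GWPA G))) ∧
    (0 < n →
      (IsField (PoissonAlgebra.center K (GWPA G)) ↔
        CharZero K ∧
        IsField (PoissonAlgebra.center K D ⊓ G.constants : Subalgebra K D) ∧
        ∀ α : Fin n → ℤ, α ≠ 0 → G.weight α = {0})) := by
  refine ⟨?_, GWPA.isField_center_iff⟩
  rw [PoissonAlgebra.isSimpleRing_diffOp_iff]
  exact ⟨fun h => ⟨GWPA.eq_bot_or_eq_top_of_isPoissonSimple h,
    GWPA.span_sup_span_eq_top_of_isPoissonSimple h, h.isField_center⟩,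
    fun h => GWPA.isPoissonSimple_of_isField_center h.1 h.2.1 h.2.2⟩
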